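/- Let $n\ge 1$ and let $\mathbb R_n$ be the real Clifford algebra generated by $e_1,\dots,e_n$ with $e_i^2=-1$, $e_ie_j+e_je_i=0$ ($i\ne j$), with the Euclidean norm $\|\sum_A y_Ae_A\|^2=\sum_A y_A^2$. A function $f:\mathbb R^{n+1}\to\mathbb R_n$ is called entire left monogenic if it is of class $C^1$ and $\partial_{x_0}f+\sum_{i=1}^n e_i\,\partial_{x_i}f=0$ on $\mathbb R^{n+1}$. For $\mathbf m\in\mathbb N_0^n$ let $$V_{\mathbf m}(\mathbf x)=\frac{\mathbf m!}{|\mathbf m|!}\sum z_{j_1}z_{j_2}\cdots z_{j_{|\mathbf m|}},\qquad z_j=x_j-x_0e_j,$$ be the Fueter polynomial, where the sum is over all distinct words $(j_1,\dots,j_{|\mathbf m|})$ in which each $j$ occurs exactly $m_j$ times. The Taylor series of an entire left monogenic $f$ is $\sum_{\mathbf m\in\mathbb N_0^n}V_{\mathbf m}(\mathbf x)a_{\mathbf m}$ with $a_{\mathbf m}=\frac1{\mathbf m!}\,\partial_{x_1}^{m_1}\cdots\partial_{x_n}^{m_n}f(0)$. Let $\rho>0$ and let $\rho(r)$ be a proximate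 order for the order $\rho$, i.e. a differentiable function $\rho(r)\ge 0$ on $r\ge 0$ with $\lim_{r\to\infty}\rho(r)=\rho$ and $\lim_{r\to\infty}\rho'(r)\,r\ln r=0$. For $\sigma>0$ let $A_{\rho,\sigma}$ be the space of entire left monogenic $f$ with $$\|f\|_{\rho,\sigma}=\sup_{\mathbf x\in\mathbb R^{n+1}}\|f(\mathbf x)\|\exp\bigl(-\sigma\|\mathbf x\|^{\rho(\|\mathbf x\|)}\bigr)<\infty .$$ Let $A_\rho=\bigcup_{\sigma>0}A_{\rho,\sigma}$ be the (locally convex) inductive limit of these spaces; $f_j\to f$ in $A_\rho$ means that for some $\sigma>0$ all $f_j$ and $f$ lie in $A_{\rho,\sigma}$ and $\|f_j-f\|_{\rho,\sigma}\to0$. For $\sigma\ge0$ let $A_{\rho,\sigma+0}=\bigcap_{\epsilon>0}A_{\rho,\sigma+\epsilon}$ be the projective limit; $f_j\to f$ in $A_{\rho,\sigma+0}$ means that $\|f_j-f\|_{\rho,\sigma+\epsilon}\to0$ for every $\epsilon>0$. Write $A_{\rho,+0}=A_{\rho,0+0}$. Then, for every $\sigma\ge0$ and every $f\in A_{\rho,\sigma+0}$,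 the Taylor series $\sum_{\mathbf m}V_{\mathbf m}(\mathbf x)a_{\mathbf m}$ of $f$ converges to $f$ in $A_{\rho,n^\rho\sigma+0}$, both unconditionally (along the finite subsets of $\mathbb N_0^n$) and for the partial sums over $|\mathbf m|\le q$, $q\to\infty$. In particular, the set of finite sums $\sum V_{\mathbf m}(\mathbf x)b_{\mathbf m}$, $b_{\mathbf m}\in\mathbb R_n$, is contained and dense in $A_{\rho,+0}$ and in $A_\rho$: every element of $A_{\rho,+0}$ (resp. of $A_\rho$) is the limit in $A_{\rho,+0}$ (resp. in $A_\rho$) of a sequence of such sums, and the set of these sums is dense for the projective limit topology (resp. for the inductive limit topology). -/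

import Mathlib

open Filter Topology

namespace Monogenic

noncomputable section

/-! ### The real Clifford algebra over `n` imaginary units -/

/-- The quadratic form `v ↦ -∑ vᵢ²` on `ℝⁿ`. -/
def cliffordForm (n : ℕ) : QuadraticForm ℝ (Fin n → ℝ) :=
  QuadraticMap.weightedSumSquares ℝ (fun _ : Fin n => (-1 : ℝ))

/-- The real Clifford algebra `ℝ_n`. -/
abbrev Cl (n : ℕ) : Type := CliffordAlgebra (cliffordForm n)

/-- The imaginary units `e_j`. -/
def imUnit (n : ℕ) (j : Fin n) : Cl n := CliffordAlgebra.ι (cliffordForm n) (Pi.single j 1)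

theorem imUnit_mul_self (n : ℕ) (j : Fin n) : imUnit n j * imUnit n j = -1 := by
  rw [imUnit, CliffordAlgebra.ι_sq_scalar]
  have h : cliffordForm n (Pi.single j 1) = -1 := by
    simp [cliffordForm, QuadraticMap.weightedSumSquares_apply, Pi.single_apply]
  rw [h, map_neg, map_one]

/-- `e_A = e_{i₁} ⋯ e_{i_r}` for `A = {i₁ < ⋯ < i_r}`; `e_∅ = 1`. -/
def unitProd (n : ℕ) (A : Finset (Fin n)) : Cl n := ((A.sort).map (imUnit n)).prod

theorem associated_single (n : ℕ) (i j : Fin n) (h : i ≠ j) :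
    QuadraticMap.associated (R := ℝ) (cliffordForm n) (Pi.single i 1) (Pi.single j 1) = 0 := by
  have h1 : ∀ x : Fin n, (Pi.single i (1 : ℝ) : Fin n → ℝ) x *
      (Pi.single j (1 : ℝ) : Fin n → ℝ) x = 0 := by
    intro x
    by_cases hx : x = i
    · subst hx
      simp [h]
    · simp [Pi.single_apply, hx]
  rw [QuadraticMap.associated_apply]
  simp only [cliffordForm, QuadraticMap.weightedSumSquares_apply, Pi.add_apply, smul_eq_mul]
  have h2 : ∀ x : Fin n,
      ((Pi.single i (1 : ℝ) : Fin n → ℝ) x + (Pi.single j (1 : ℝ) : Fin n → ℝ) x) *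
        ((Pi.single i (1 : ℝ) : Fin n → ℝ) x + (Pi.single j (1 : ℝ) : Fin n → ℝ) x) =
      (Pi.single i (1 : ℝ) : Fin n → ℝ) x * (Pi.single i (1 : ℝ) : Fin n → ℝ) x +
      (Pi.single j (1 : ℝ) : Fin n → ℝ) x * (Pi.single j (1 : ℝ) : Fin n → ℝ) x := by
    intro x
    linear_combination 2 * h1 x
  simp only [h2, mul_add, Finset.sum_add_distrib]
  simp

theorem contract_prod_eq_zero (n : ℕ) (d : Module.Dual ℝ (Fin n → ℝ)) (l : List (Fin n))
    (h : ∀ j ∈ l, d (Pi.single j 1) = 0) :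
    CliffordAlgebra.contractLeft d ((l.map (imUnit n)).prod) = 0 := by
  induction l with
  | nil => simp
  | cons a l ih =>
    rw [List.map_cons, List.prod_cons, imUnit, CliffordAlgebra.contractLeft_ι_mul,
      h a (by simp), ih (fun j hj => h j (by simp [hj]))]
    simp

theorem associated_toQuadraticMap (n : ℕ) :
    (QuadraticMap.associated (R := ℝ) (cliffordForm n)).toQuadraticMap = cliffordForm n - 0 := by
  simp [QuadraticMap.toQuadraticMap_associated]

theorem changeForm_prod (n : ℕ) (l : List (Fin n)) (h : l.Nodup) :
    CliffordAlgebra.changeForm (associated_toQuadraticMap n)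
      ((l.map (fun j => ExteriorAlgebra.ι ℝ (Pi.single j (1 : ℝ) : Fin n → ℝ))).prod) =
      (l.map (imUnit n)).prod := by
  induction l with
  | nil => simp
  | cons a l ih =>
    rw [List.nodup_cons] at h
    rw [List.map_cons, List.prod_cons, List.map_cons, List.prod_cons]
    erw [CliffordAlgebra.changeForm_ι_mul]
    erw [ih h.2]
    rw [contract_prod_eq_zero n _ l, sub_zero, imUnit]
    intro j hj
    exact associated_single n a j (fun e => h.1 (e ▸ hj))

theorem unitProd_eq (n : ℕ) (A : Finset (Fin n)) :
    CliffordAlgebra.changeFormEquiv (associated_toQuadraticMap n)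
      ((Pi.basisFun ℝ (Fin n)).ExteriorAlgebra A) = unitProd n A := by
  rw [ExteriorAlgebra.basis_apply_ofCard _ (rfl : A.card = A.card), CliffordAlgebra.changeFormEquiv_apply, unitProd,
    ← changeForm_prod n _ (A.sort_nodup (· ≤ ·))]
  congr 1
  refine (ExteriorAlgebra.ιMulti_apply _).trans ?_
  congr 1
  apply List.ext_getElem
  · simp
  · intro i h1 h2
    simp [Set.powersetCard.ofFinEmbEquiv_symm_apply, Finset.orderEmbOfFin_apply]

/-- The basis `(e_A)` of `ℝ_n`. -/
def clBasis (n : ℕ) : Module.Basis (Finset (Fin n)) ℝ (Cl n) :=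
  ((Pi.basisFun ℝ (Fin n)).ExteriorAlgebra).map
    (CliffordAlgebra.changeFormEquiv (associated_toQuadraticMap n))

theorem clBasis_apply (n : ℕ) (A : Finset (Fin n)) : clBasis n A = unitProd n A := by
  rw [clBasis, Module.Basis.map_apply, unitProd_eq]

/-- The coordinates `(y_A)` of `y = ∑ y_A e_A`. -/
def clCoord (n : ℕ) : Cl n ≃ₗ[ℝ] EuclideanSpace ℝ (Finset (Fin n)) :=
  (clBasis n).equivFun.trans (WithLp.linearEquiv 2 ℝ (Finset (Fin n) → ℝ)).symm

/-- The Euclidean norm `|y|² = ∑_A |y_A|²` on `ℝ_n`. -/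
instance clNormedAddCommGroup (n : ℕ) : NormedAddCommGroup (Cl n) :=
  NormedAddCommGroup.induced (Cl n) (EuclideanSpace ℝ (Finset (Fin n))) (clCoord n)
    (clCoord n).injective

instance clNormedSpace (n : ℕ) : NormedSpace ℝ (Cl n) :=
  NormedSpace.induced ℝ (Cl n) (EuclideanSpace ℝ (Finset (Fin n))) (clCoord n)

theorem cl_norm_eq (n : ℕ) (y : Cl n) :
    ‖y‖ = Real.sqrt (∑ A : Finset (Fin n), ((clBasis n).repr y A) ^ 2) := by
  change ‖clCoord n y‖ = _
  simp [EuclideanSpace.norm_eq, clCoord]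

/-! ### Monogenic functions and Fueter polynomials -/

/-- `ℝ^{n+1}`, with coordinates `x_0, x_1, …, x_n` and the Euclidean norm. -/
abbrev E (n : ℕ) : Type := EuclideanSpace ℝ (Fin (n + 1))

/-- The partial derivative `∂_{x_i} f`. -/
def partialDeriv {n : ℕ} (i : Fin (n + 1)) (f : E n → Cl n) : E n → Cl n :=
  fun x => fderiv ℝ f x (EuclideanSpace.single i 1)

/-- The operator `𝒟 f = ∂_{x_0} f + ∑ e_i ∂_{x_i} f`. -/
def dirac {n : ℕ} (f : E n → Cl n) : E n → Cl n :=
  fun x => partialDeriv 0 f x + ∑ i : Fin n, imUnit n i * partialDeriv i.succ f x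

/-- Entire left monogenic functions. -/
def IsMonogenic {n : ℕ} (f : E n → Cl n) : Prop :=
  ContDiff ℝ 1 f ∧ ∀ x, dirac f x = 0

/-- `∂_{x_1}^{m_1} ⋯ ∂_{x_n}^{m_n} f`. -/
def multiDeriv {n : ℕ} (m : Fin n → ℕ) (f : E n → Cl n) : E n → Cl n :=
  (List.finRange n).foldr (fun j g => (partialDeriv j.succ)^[m j] g) f

/-- The Taylor coefficient `a_m = (1 / m!) ∂^m f(0)`. -/
def taylorCoeff {n : ℕ} (f : E n → Cl n) (m : Fin n → ℕ) : Cl n :=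
  ((∏ j, (m j).factorial : ℕ) : ℝ)⁻¹ • multiDeriv m f 0

/-- The variable `z_j = x_j - x_0 e_j`. -/
def fueterVar {n : ℕ} (j : Fin n) (x : E n) : Cl n :=
  algebraMap ℝ (Cl n) (x j.succ) - x 0 • imUnit n j

/-- The words of length `|m|` in which every index `j` occurs exactly `m_j` times, i.e. the
distinct permutations of `(1,…,1,2,…,2,…,n,…,n)`. -/
def fueterWords {n : ℕ} (m : Fin n → ℕ) : Finset (Fin (∑ j, m j) → Fin n) :=
  Finset.univ.filter fun w => ∀ j, (Finset.univ.filter fun i => w i = j).card = m j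

/-- The Fueter polynomial `V_m = (m! / |m|!) ∑ z_{j_1} ⋯ z_{j_{|m|}}`, the sum being over the
distinct permutations `(j_1, …, j_{|m|})` of the word in which `j` occurs `m_j` times. -/
def fueter {n : ℕ} (m : Fin n → ℕ) (x : E n) : Cl n :=
  (((∏ j, (m j).factorial : ℕ) : ℝ) / ((∑ j, m j).factorial : ℝ)) •
    ∑ w ∈ fueterWords m, (List.ofFn fun i => fueterVar (w i) x).prod

/-- The finite sums `∑ V_m b_m` with `b_m ∈ ℝ_n`. -/
def fueterPolynomials (n : ℕ) : Set (E n → Cl n) :=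
  {p | ∃ (s : Finset (Fin n → ℕ)) (b : (Fin n → ℕ) → Cl n),
    p = fun x => ∑ m ∈ s, fueter m x * b m}

/-- The partial sum over `m ∈ s` of the Taylor series `∑ V_m a_m` of `f`. -/
def taylorSum {n : ℕ} (f : E n → Cl n) (s : Finset (Fin n → ℕ)) : E n → Cl n :=
  fun x => ∑ m ∈ s, fueter m x * taylorCoeff f m

/-- The multi-indices with `|m| ≤ q`. -/
def multiIndexLE (n q : ℕ) : Finset (Fin n → ℕ) :=
  (Fintype.piFinset fun _ : Fin n => Finset.range (q + 1)).filter fun m => ∑ j, m j ≤ q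

theorem mem_multiIndexLE {n q : ℕ} {m : Fin n → ℕ} :
    m ∈ multiIndexLE n q ↔ ∑ j, m j ≤ q := by
  simp only [multiIndexLE, Finset.mem_filter, Fintype.mem_piFinset, Finset.mem_range,
    and_iff_right_iff_imp]
  intro h j
  have := Finset.single_le_sum (f := m) (fun _ _ => Nat.zero_le _) (Finset.mem_univ j)
  omega

/-! ### Proximate orders and the spaces of entire monogenic functions -/

/-- `ρ(r)` is a proximate order for the order `ord`. Only the values at `r ≥ 0` matter. -/
structure IsProximateOrder (ρ : ℝ → ℝ) (ord : ℝ) : Prop where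
  nonneg : ∀ r, 0 ≤ r → 0 ≤ ρ r
  differentiableOn : DifferentiableOn ℝ ρ (Set.Ici 0)
  tendsto : Tendsto ρ atTop (𝓝 ord)
  tendsto_deriv : Tendsto (fun r => deriv ρ r * r * Real.log r) atTop (𝓝 0)

/-- `‖f‖_{ρ,σ} = sup_x |f(x)| exp(-σ |x|^{ρ(|x|)})`, with value `∞` if unbounded. -/
def growthNorm {n : ℕ} (ρ : ℝ → ℝ) (σ : ℝ) (f : E n → Cl n) : ENNReal :=
  ⨆ x : E n, ENNReal.ofReal (‖f x‖ * Real.exp (-σ * ‖x‖ ^ ρ ‖x‖))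

theorem growthNorm_add_le {n : ℕ} (ρ : ℝ → ℝ) (σ : ℝ) (f g : E n → Cl n) :
    growthNorm ρ σ (f + g) ≤ growthNorm ρ σ f + growthNorm ρ σ g := by
  refine iSup_le fun x => ?_
  refine le_trans ?_ (add_le_add (le_iSup _ x) (le_iSup _ x))
  rw [← ENNReal.ofReal_add (by positivity) (by positivity), ← add_mul]
  exact ENNReal.ofReal_le_ofReal
    (mul_le_mul_of_nonneg_right (norm_add_le _ _) (Real.exp_pos _).le)

theorem growthNorm_smul {n : ℕ} (ρ : ℝ → ℝ) (σ c : ℝ) (f : E n → Cl n) :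
    growthNorm ρ σ (c • f) = ENNReal.ofReal |c| * growthNorm ρ σ f := by
  rw [growthNorm, growthNorm, ENNReal.mul_iSup]
  refine iSup_congr fun x => ?_
  rw [← ENNReal.ofReal_mul (abs_nonneg c), Pi.smul_apply, norm_smul, Real.norm_eq_abs, mul_assoc]

theorem growthNorm_zero {n : ℕ} (ρ : ℝ → ℝ) (σ : ℝ) :
    growthNorm ρ σ (0 : E n → Cl n) = 0 := by
  simp [growthNorm]

theorem growthNorm_eq_zero {n : ℕ} {ρ : ℝ → ℝ} {σ : ℝ} {f : E n → Cl n}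
    (h : growthNorm ρ σ f = 0) : f = 0 := by
  funext x
  have h1 := ENNReal.iSup_eq_zero.mp h x
  rw [ENNReal.ofReal_eq_zero] at h1
  have h2 := nonpos_of_mul_nonpos_left h1 (Real.exp_pos _)
  simpa using h2

theorem growthNorm_anti {n : ℕ} (ρ : ℝ → ℝ) {σ τ : ℝ} (h : σ ≤ τ) (f : E n → Cl n) :
    growthNorm ρ τ f ≤ growthNorm ρ σ f := by
  refine iSup_mono fun x => ENNReal.ofReal_le_ofReal ?_
  refine mul_le_mul_of_nonneg_left (Real.exp_le_exp.mpr ?_) (norm_nonneg _)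
  exact mul_le_mul_of_nonneg_right (neg_le_neg h) (Real.rpow_nonneg (norm_nonneg x) _)

theorem isMonogenic_zero {n : ℕ} : IsMonogenic (0 : E n → Cl n) := by
  refine ⟨contDiff_const, fun x => ?_⟩
  have h : ∀ i, partialDeriv i (0 : E n → Cl n) x = 0 := by
    intro i
    simp [partialDeriv]
  simp [dirac, h]

theorem IsMonogenic.add {n : ℕ} {f g : E n → Cl n} (hf : IsMonogenic f) (hg : IsMonogenic g) :
    IsMonogenic (f + g) := by
  refine ⟨hf.1.add hg.1, fun x => ?_⟩
  have h : ∀ i, partialDeriv i (f + g) x = partialDeriv i f x + partialDeriv i g x := by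
    intro i
    simp only [partialDeriv]
    rw [fderiv_add (hf.1.differentiable one_ne_zero x) (hg.1.differentiable one_ne_zero x)]
    rfl
  have h1 := hf.2 x
  have h2 := hg.2 x
  simp only [dirac] at h1 h2 ⊢
  simp only [h, mul_add, Finset.sum_add_distrib]
  rw [add_add_add_comm, h1, h2, add_zero]

theorem IsMonogenic.smul {n : ℕ} {f : E n → Cl n} (c : ℝ) (hf : IsMonogenic f) :
    IsMonogenic (c • f) := by
  refine ⟨contDiff_const.smul hf.1, fun x => ?_⟩
  have h : ∀ i, partialDeriv i (c • f) x = c • partialDeriv i f x := by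
    intro i
    simp only [partialDeriv]
    rw [fderiv_const_smul (hf.1.differentiable one_ne_zero x)]
    rfl
  have h1 := hf.2 x
  simp only [dirac] at h1 ⊢
  simp only [h, mul_smul_comm, ← Finset.smul_sum, ← smul_add]
  rw [h1, smul_zero]

/-- The space `A_{ρ,σ}`. -/
def A (n : ℕ) (ρ : ℝ → ℝ) (σ : ℝ) : Submodule ℝ (E n → Cl n) where
  carrier := {f | IsMonogenic f ∧ growthNorm ρ σ f < ⊤}
  zero_mem' := ⟨isMonogenic_zero, by simp [growthNorm_zero]⟩
  add_mem' := fun hf hg => ⟨hf.1.add hg.1,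
    (growthNorm_add_le ρ σ _ _).trans_lt (ENNReal.add_lt_top.mpr ⟨hf.2, hg.2⟩)⟩
  smul_mem' := fun c f hf => ⟨hf.1.smul c, by
    rw [growthNorm_smul]
    exact ENNReal.mul_lt_top ENNReal.ofReal_lt_top hf.2⟩

theorem A_mono (n : ℕ) (ρ : ℝ → ℝ) {σ τ : ℝ} (h : σ ≤ τ) : A n ρ σ ≤ A n ρ τ :=
  fun f hf => ⟨hf.1, (growthNorm_anti ρ h f).trans_lt hf.2⟩

/-- The norm topology of `A_{ρ,σ}`. -/
def A.groupNorm (n : ℕ) (ρ : ℝ → ℝ) (σ : ℝ) : AddGroupNorm (A n ρ σ) where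
  toFun f := (growthNorm ρ σ (f : E n → Cl n)).toReal
  map_zero' := by simp [growthNorm_zero]
  add_le' f g := by
    rw [← ENNReal.toReal_add f.2.2.ne g.2.2.ne]
    exact ENNReal.toReal_mono (ENNReal.add_ne_top.mpr ⟨f.2.2.ne, g.2.2.ne⟩)
      (growthNorm_add_le ρ σ _ _)
  neg' f := by
    have h : ((-f : A n ρ σ) : E n → Cl n) = (-1 : ℝ) • (f : E n → Cl n) := by simp
    rw [h, growthNorm_smul]
    simp
  eq_zero_of_map_eq_zero' f h := by
    have h1 := (ENNReal.toReal_eq_zero_iff _).mp h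
    exact Subtype.ext (growthNorm_eq_zero (h1.resolve_right f.2.2.ne))

/-- The topology of `A_{ρ,σ}` defined by the norm `‖·‖_{ρ,σ}`. -/
abbrev A.topology (n : ℕ) (ρ : ℝ → ℝ) (σ : ℝ) : TopologicalSpace (A n ρ σ) :=
  (A.groupNorm n ρ σ).toNormedAddCommGroup.toMetricSpace.toPseudoMetricSpace.toUniformSpace.toTopologicalSpace

/-- The space `A_ρ = ⋃_{σ > 0} A_{ρ,σ}`. -/
def AInd (n : ℕ) (ρ : ℝ → ℝ) : Submodule ℝ (E n → Cl n) where
  carrier := {f | ∃ σ : ℝ, 0 < σ ∧ f ∈ A n ρ σ}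
  zero_mem' := ⟨1, one_pos, Submodule.zero_mem _⟩
  add_mem' := by
    rintro f g ⟨σ, hσ, hf⟩ ⟨τ, _, hg⟩
    exact ⟨max σ τ, lt_max_of_lt_left hσ, Submodule.add_mem _
      (A_mono n ρ (le_max_left σ τ) hf) (A_mono n ρ (le_max_right σ τ) hg)⟩
  smul_mem' := by
    rintro c f ⟨σ, hσ, hf⟩
    exact ⟨σ, hσ, Submodule.smul_mem _ c hf⟩

theorem A_le_AInd (n : ℕ) (ρ : ℝ → ℝ) {σ : ℝ} (hσ : 0 < σ) : A n ρ σ ≤ AInd n ρ :=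
  fun _ hf => ⟨σ, hσ, hf⟩

/-- The locally convex inductive limit topology of `A_ρ`: the finest locally convex vector space
topology for which all the inclusions `A_{ρ,σ} → A_ρ` are continuous. -/
abbrev AInd.topology (n : ℕ) (ρ : ℝ → ℝ) : TopologicalSpace (AInd n ρ) :=
  sInf {t | @IsTopologicalAddGroup (AInd n ρ) t _ ∧ @ContinuousSMul ℝ (AInd n ρ) _ _ t ∧
    @LocallyConvexSpace ℝ (AInd n ρ) _ _ _ _ t ∧
    ∀ (σ : ℝ) (hσ : 0 < σ),
      @Continuous _ _ (A.topology n ρ σ) t (Submodule.inclusion (A_le_AInd n ρ hσ))}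

/-- The space `A_{ρ,σ+0} = ⋂_{ε > 0} A_{ρ,σ+ε}`. -/
def APlus (n : ℕ) (ρ : ℝ → ℝ) (σ : ℝ) : Submodule ℝ (E n → Cl n) where
  carrier := {f | ∀ ε : ℝ, 0 < ε → f ∈ A n ρ (σ + ε)}
  zero_mem' := fun _ _ => Submodule.zero_mem _
  add_mem' := fun hf hg ε hε => Submodule.add_mem _ (hf ε hε) (hg ε hε)
  smul_mem' := fun c _ hf ε hε => Submodule.smul_mem _ c (hf ε hε)

theorem APlus_le_A (n : ℕ) (ρ : ℝ → ℝ) (σ : ℝ) {ε : ℝ} (hε : 0 < ε) :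
    APlus n ρ σ ≤ A n ρ (σ + ε) :=
  fun _ hf => hf ε hε

/-- The projective limit topology of `A_{ρ,σ+0}`: the coarsest topology for which all the
inclusions `A_{ρ,σ+0} → A_{ρ,σ+ε}` are continuous. -/
abbrev APlus.topology (n : ℕ) (ρ : ℝ → ℝ) (σ : ℝ) : TopologicalSpace (APlus n ρ σ) :=
  ⨅ (ε : ℝ) (hε : 0 < ε),
    (A.topology n ρ (σ + ε)).induced (Submodule.inclusion (APlus_le_A n ρ σ hε))

/-- `u → f` in `A_{ρ,σ+0}` along the filter `l`; for sequences take `l = atTop`. -/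
def ConvergesAPlus {n : ℕ} {ι : Type*} (ρ : ℝ → ℝ) (σ : ℝ) (l : Filter ι)
    (u : ι → E n → Cl n) (f : E n → Cl n) : Prop :=
  ∀ ε : ℝ, 0 < ε → (∀ i, u i ∈ A n ρ (σ + ε)) ∧ f ∈ A n ρ (σ + ε) ∧
    Tendsto (fun i => growthNorm ρ (σ + ε) (u i - f)) l (𝓝 0)

/-- `u → f` in `A_ρ` along the filter `l`; for sequences take `l = atTop`. -/
def ConvergesAInd {n : ℕ} {ι : Type*} (ρ : ℝ → ℝ) (l : Filter ι)
    (u : ι → E n → Cl n) (f : E n → Cl n) : Prop :=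
  ∃ σ : ℝ, 0 < σ ∧ (∀ i, u i ∈ A n ρ σ) ∧ f ∈ A n ρ σ ∧
    Tendsto (fun i => growthNorm ρ σ (u i - f)) l (𝓝 0)

end

end Monogenic

open Monogenic

namespace Monogenic

/-! ### Left multiplication by paravectors -/

/-! The proof rests on a Cauchy estimate whose dependence on the order $k$ of the derivative is
sharp up to a factor independent of $k$: a derivative of order $k$ at $p$ is at most $C_\delta\,
n(n+1)\cdots(n+k-1)\,M r^{-k}$, where $M$ bounds $\|f\|$ on the ball of radius $(1+\delta)r$
(`exists_cauchy_estimate`). Up to the factor $k!$ the rising factorial is polynomial in $k$, so no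
geometric factor is lost.

Two facts produce it. Left multiplication by a paravector multiplies the Euclidean norm exactly by
the length (`norm_paravector_mul`), although that norm need not be submultiplicative. And
differentiating the Cauchy kernel costs only its current degree of homogeneity, if $|x|^{-(n-1)}$
and $\bar x/|x|^2=x^{-1}$ are differentiated as inverses in the algebra
(`KernelBound.partialDeriv`). The kernel is linked to $f$ by the Cauchy–Pompeiu formula for $\chi f$
with a cutoff $\chi$, which also gives smoothness.

Monogenicity eliminates $\partial_{x_0}$, so the derivative of $f$ in direction $x$ is $\sum_j
z_j(x)\,\partial_{x_j}f$. Iterating it, the degree $k$ part of the Taylor expansion is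
$\frac1{k!}\sum z_{j_1}\cdots z_{j_k}\,\partial_{j_1}\cdots\partial_{j_k}f(0)$ over all $n^k$ words;
grouping words by their letter counts gives $\sum_{|\mathbf m|=k}V_{\mathbf m}a_{\mathbf m}$
(`fueter_mul_taylorCoeff`, `tendsto_taylorSum_multiIndexLE`).

Each word contributes at most $\|x\|^k$ times the Cauchy bound. Taking $r=(1+\eta)n\|x\|$ for large
$\|x\|$ absorbs the $n^k$ words and leaves a convergent binomial series in $(1+\eta)^{-1}$. The
price is that $f$ is measured at radius about $n\|x\|$; since $r^{\rho(r)}$ varies regularly with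
index $\rho$ (`IsProximateOrder.exists_rpow_le`), the type grows from $\sigma$ to $n^\rho\sigma$.
The resulting bound is a summable sequence times one weight (`exists_summable_bound`), so the tails
tend to $0$ in norm, and density follows because the partial sums are admissible finite sums. -/

theorem imUnit_mul_add_swap (n : ℕ) {i j : Fin n} (h : i ≠ j) :
    imUnit n i * imUnit n j + imUnit n j * imUnit n i = 0 := by
  have hp : QuadraticMap.polar (cliffordForm n) (Pi.single i 1) (Pi.single j 1) = 0 := by
    have h1 := associated_single n i j h
    have h2 := QuadraticMap.two_nsmul_associated (S := ℝ) (Q := cliffordForm n)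
    have h3 := congrArg (fun B => B (Pi.single i 1) (Pi.single j 1)) h2
    simp only [LinearMap.smul_apply] at h3
    rw [QuadraticMap.associated_apply] at h1
    rw [← QuadraticMap.polarBilin_apply_apply, ← h3, QuadraticMap.associated_apply, h1, smul_zero]
  rw [imUnit, imUnit, CliffordAlgebra.ι_mul_ι_add_swap, hp, map_zero]

theorem imUnit_mul_imUnit_mul (n : ℕ) (j : Fin n) (a : Cl n) :
    imUnit n j * (imUnit n j * a) = -a := by
  rw [← mul_assoc, imUnit_mul_self, neg_one_mul]

/-- Each transposition of neighbours either changes the sign or swaps equal units. The sign is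
recorded as a real $s$ with $s^2=1$. -/
theorem prod_map_imUnit_perm (n : ℕ) {l l' : List (Fin n)} (h : l.Perm l') :
    ∃ s : ℝ, s * s = 1 ∧ (l.map (imUnit n)).prod = s • (l'.map (imUnit n)).prod := by
  induction h with
  | nil => exact ⟨1, by norm_num, by simp⟩
  | cons a _ ih =>
    obtain ⟨s, hs, e⟩ := ih
    exact ⟨s, hs, by simp [e]⟩
  | swap a b l =>
    by_cases hab : a = b
    · subst hab
      exact ⟨1, by norm_num, by simp⟩
    · refine ⟨-1, by norm_num, ?_⟩
      have := eq_neg_of_add_eq_zero_left (imUnit_mul_add_swap n (Ne.symm hab))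
      simp only [List.map_cons, List.prod_cons, ← mul_assoc, this]
      simp
  | trans _ _ ih1 ih2 =>
    obtain ⟨s, hs, e⟩ := ih1
    obtain ⟨t, ht, e'⟩ := ih2
    exact ⟨s * t, by linear_combination hs * t * t + ht, by rw [e, e', smul_smul]⟩

theorem imUnit_mul_unitProd_of_notMem (n : ℕ) (j : Fin n) (S : Finset (Fin n)) (h : j ∉ S) :
    ∃ s : ℝ, s * s = 1 ∧ imUnit n j * unitProd n S = s • unitProd n (insert j S) := by
  have hp : (j :: S.sort).Perm ((insert j S).sort) := by
    refine (List.perm_ext_iff_of_nodup ?_ (Finset.sort_nodup _ _)).mpr fun a => by simp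
    exact List.nodup_cons.mpr ⟨by simpa using h, Finset.sort_nodup _ _⟩
  obtain ⟨s, hs, e⟩ := prod_map_imUnit_perm n hp
  exact ⟨s, hs, by simpa [unitProd] using e⟩

theorem imUnit_mul_clBasis (n : ℕ) (j : Fin n) (S : Finset (Fin n)) :
    ∃ s : ℝ, s * s = 1 ∧ imUnit n j * clBasis n S = s • clBasis n (symmDiff S {j}) := by
  simp only [clBasis_apply]
  by_cases h : j ∈ S
  · obtain ⟨s, hs, e⟩ := imUnit_mul_unitProd_of_notMem n j (S.erase j) (by simp)
    rw [Finset.insert_erase h] at e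
    have hS : symmDiff S {j} = S.erase j := by
      ext a; simp only [Finset.mem_symmDiff, Finset.mem_singleton, Finset.mem_erase]; grind
    refine ⟨-s, by linear_combination hs, ?_⟩
    have e2 : unitProd n S = s • (imUnit n j * unitProd n (S.erase j)) := by
      rw [e, smul_smul, hs, one_smul]
    rw [hS, e2, mul_smul_comm, imUnit_mul_imUnit_mul]
    simp
  · obtain ⟨s, hs, e⟩ := imUnit_mul_unitProd_of_notMem n j S h
    have hS : symmDiff S {j} = insert j S := by
      ext a; simp only [Finset.mem_symmDiff, Finset.mem_singleton, Finset.mem_insert]; grind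
    exact ⟨s, hs, by rw [hS, e]⟩

/-- The Euclidean inner product of `ℝ_n`. -/
noncomputable def clInner (n : ℕ) : Cl n →ₗ[ℝ] Cl n →ₗ[ℝ] ℝ :=
  (innerₗ (EuclideanSpace ℝ (Finset (Fin n)))).compl₁₂ (clCoord n).toLinearMap
    (clCoord n).toLinearMap

theorem clInner_self (n : ℕ) (a : Cl n) : clInner n a a = ‖a‖ ^ 2 :=
  real_inner_self_eq_norm_sq (clCoord n a)

theorem clInner_basis (n : ℕ) (S T : Finset (Fin n)) :
    clInner n (clBasis n S) (clBasis n T) = if S = T then 1 else 0 := by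
  have h : ∀ S, clCoord n (clBasis n S) = EuclideanSpace.single S (1 : ℝ) := by
    intro S
    ext T
    simp [clCoord, Finsupp.single_apply, eq_comm]
  change inner ℝ (clCoord n (clBasis n S)) (clCoord n (clBasis n T)) = _
  rw [h, h]
  simp [EuclideanSpace.inner_single_left]

/-- Multiplication by $e_j$ permutes the orthonormal basis up to signs and squares to $-1$; such a
map is skew-adjoint. -/
theorem clInner_imUnit_mul (n : ℕ) (j : Fin n) (a b : Cl n) :
    clInner n (imUnit n j * a) b = -clInner n a (imUnit n j * b) := by
  suffices h : (clInner n).comp (LinearMap.mulLeft ℝ (imUnit n j)) =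
      -(clInner n).compl₂ (LinearMap.mulLeft ℝ (imUnit n j)) by
    simpa using congrArg (fun B => B a b) h
  refine (clBasis n).ext fun S => (clBasis n).ext fun T => ?_
  simp only [LinearMap.comp_apply, LinearMap.mulLeft_apply, LinearMap.neg_apply,
    LinearMap.compl₂_apply]
  obtain ⟨s, hs, es⟩ := imUnit_mul_clBasis n j S
  obtain ⟨t, ht, et⟩ := imUnit_mul_clBasis n j T
  rw [es, et]
  simp only [map_smul, LinearMap.smul_apply, clInner_basis, smul_eq_mul]
  by_cases hST : symmDiff S {j} = T
  · have hTS : S = symmDiff T {j} := by rw [← hST, symmDiff_symmDiff_cancel_right]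
    rw [if_pos hST, if_pos hTS]
    -- Going from $S$ to $T$ and back multiplies by $st$, while $e_j^2=-1$; hence $st=-1$, so
    -- $s=-t$.
    have h1 : imUnit n j * (imUnit n j * clBasis n S) = (s * t) • clBasis n S := by
      rw [es, mul_smul_comm, hST, et, ← hTS, smul_smul]
    rw [imUnit_mul_imUnit_mul] at h1
    have h2 := congrArg (fun a => clInner n a (clBasis n S)) h1
    simp only [map_neg, LinearMap.neg_apply, map_smul, LinearMap.smul_apply, clInner_basis,
      if_true, smul_eq_mul] at h2
    linear_combination t * h2 * (-1) + s * ht * (-1)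
  · have hTS : S ≠ symmDiff T {j} := fun e =>
      hST (by rw [e, symmDiff_symmDiff_cancel_right])
    rw [if_neg hST, if_neg hTS]
    simp

instance (n : ℕ) : FiniteDimensional ℝ (Cl n) := (clBasis n).finiteDimensional_of_finite

instance (n : ℕ) : CompleteSpace (Cl n) := FiniteDimensional.complete ℝ (Cl n)

/-- The units `e_0 = 1, e_1, …, e_n`. -/
noncomputable def unit (n : ℕ) : Fin (n + 1) → Cl n := Fin.cons 1 (imUnit n)

/-- The conjugate units `1, -e_1, …, -e_n`. -/
noncomputable def unitConj (n : ℕ) : Fin (n + 1) → Cl n := Fin.cons 1 fun j => -imUnit n j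

@[simp] theorem unit_zero (n : ℕ) : unit n 0 = 1 := rfl
@[simp] theorem unit_succ (n : ℕ) (j : Fin n) : unit n j.succ = imUnit n j := rfl
@[simp] theorem unitConj_zero (n : ℕ) : unitConj n 0 = 1 := rfl
@[simp] theorem unitConj_succ (n : ℕ) (j : Fin n) : unitConj n j.succ = -imUnit n j := rfl

/-- The paravector `x_0 + ∑ x_j e_j`. -/
noncomputable def paravector (n : ℕ) : E n →L[ℝ] Cl n :=
  ∑ i, (EuclideanSpace.proj (𝕜 := ℝ) i).smulRight (unit n i)

/-- The conjugate paravector `x_0 - ∑ x_j e_j`. -/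
noncomputable def paravectorConj (n : ℕ) : E n →L[ℝ] Cl n :=
  ∑ i, (EuclideanSpace.proj (𝕜 := ℝ) i).smulRight (unitConj n i)

theorem paravector_apply (n : ℕ) (x : E n) : paravector n x = ∑ i, x i • unit n i := by
  simp [paravector]

theorem paravectorConj_apply (n : ℕ) (x : E n) :
    paravectorConj n x = ∑ i, x i • unitConj n i := by
  simp [paravectorConj]

theorem clInner_unit_mul (n : ℕ) (i : Fin (n + 1)) (a b : Cl n) :
    clInner n (unit n i * a) b = clInner n a (unitConj n i * b) := by
  refine Fin.cases ?_ (fun j => ?_) i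
  · simp
  · simp [clInner_imUnit_mul]

theorem clInner_paravector_mul (n : ℕ) (x : E n) (a b : Cl n) :
    clInner n (paravector n x * a) b = clInner n a (paravectorConj n x * b) := by
  simp only [paravector_apply, paravectorConj_apply, Finset.sum_mul, map_sum, LinearMap.sum_apply,
    smul_mul_assoc, map_smul, LinearMap.smul_apply, clInner_unit_mul]

theorem unit_mul_unitConj_add (n : ℕ) (i j : Fin (n + 1)) :
    unit n i * unitConj n j + unit n j * unitConj n i = if i = j then 2 else 0 := by
  refine Fin.cases ?_ (fun i => ?_) i <;> refine Fin.cases ?_ (fun j => ?_) j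
  · simp; norm_num
  · simp [(Fin.succ_ne_zero _).symm]
  · simp [Fin.succ_ne_zero]
  · by_cases h : i = j
    · subst h; simp [imUnit_mul_self]; norm_num
    · have := imUnit_mul_add_swap n h
      simp [h, ← neg_add, this]

theorem unitConj_mul_unit_add (n : ℕ) (i j : Fin (n + 1)) :
    unitConj n i * unit n j + unitConj n j * unit n i = if i = j then 2 else 0 := by
  refine Fin.cases ?_ (fun i => ?_) i <;> refine Fin.cases ?_ (fun j => ?_) j
  · simp; norm_num
  · simp [(Fin.succ_ne_zero _).symm]
  · simp [Fin.succ_ne_zero]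
  · by_cases h : i = j
    · subst h; simp [imUnit_mul_self]; norm_num
    · have := imUnit_mul_add_swap n h
      simp [h, ← neg_add, this]

theorem sum_smul_mul_sum_smul_add (n : ℕ) {u v : Fin (n + 1) → Cl n}
    (huv : ∀ i j, u i * v j + u j * v i = if i = j then 2 else 0) (x y : E n) :
    (∑ i, x i • u i) * (∑ i, y i • v i) + (∑ i, y i • u i) * (∑ i, x i • v i) =
      algebraMap ℝ (Cl n) (2 * inner ℝ x y) := by
  have h : ∀ x y : E n, (∑ i, x i • u i) * (∑ i, y i • v i) =
      ∑ i, ∑ j, (x i * y j) • (u i * v j) := by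
    intro x y
    simp [Finset.sum_mul_sum, smul_smul, mul_comm]
  rw [h x y, h y x, Finset.sum_comm (f := fun i j => (y i * x j) • (u i * v j)),
    ← Finset.sum_add_distrib]
  simp only [← Finset.sum_add_distrib]
  have h2 : ∀ i j, (x i * y j) • (u i * v j) +
      (y j * x i) • (u j * v i) = if i = j then (x i * y i) • (2 : Cl n) else 0 := by
    intro i j
    rw [mul_comm (y j), ← smul_add, huv]
    split_ifs with hij <;> simp [hij]
  have h3 : inner ℝ x y = ∑ i, x i * y i := by
    rw [PiLp.inner_apply]
    simp [mul_comm]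
  simp only [h2, Finset.sum_ite_eq, Finset.mem_univ, if_true, ← Finset.sum_smul]
  rw [h3, Algebra.algebraMap_eq_smul_one, mul_comm, mul_smul, two_smul ℝ (1 : Cl n),
    one_add_one_eq_two]

theorem paravector_mul_conj_add (n : ℕ) (x y : E n) :
    paravector n x * paravectorConj n y + paravector n y * paravectorConj n x =
      algebraMap ℝ (Cl n) (2 * inner ℝ x y) := by
  simp only [paravector_apply, paravectorConj_apply]
  exact sum_smul_mul_sum_smul_add n (unit_mul_unitConj_add n) x y

theorem paravectorConj_mul_add (n : ℕ) (x y : E n) :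
    paravectorConj n x * paravector n y + paravectorConj n y * paravector n x =
      algebraMap ℝ (Cl n) (2 * inner ℝ x y) := by
  simp only [paravector_apply, paravectorConj_apply]
  exact sum_smul_mul_sum_smul_add n (unitConj_mul_unit_add n) x y

theorem eq_of_add_self_eq {M : Type*} [AddCommGroup M] [Module ℝ M] {a b : M} (h : a + a = b + b) :
    a = b := by
  rw [← two_smul ℝ a, ← two_smul ℝ b] at h
  exact smul_right_injective M two_ne_zero h

theorem paravector_mul_conj (n : ℕ) (x : E n) :
    paravector n x * paravectorConj n x = algebraMap ℝ (Cl n) (‖x‖ ^ 2) := by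
  apply eq_of_add_self_eq
  rw [paravector_mul_conj_add, ← map_add, real_inner_self_eq_norm_sq, two_mul]

theorem paravectorConj_mul (n : ℕ) (x : E n) :
    paravectorConj n x * paravector n x = algebraMap ℝ (Cl n) (‖x‖ ^ 2) := by
  apply eq_of_add_self_eq
  rw [paravectorConj_mul_add, ← map_add, real_inner_self_eq_norm_sq, two_mul]

/-- The adjoint of multiplication by $x$ is multiplication by $\bar x$, and $\bar x x=\|x\|^2$. The
equality has constant $1$, unlike the general bound `norm_mul_le_clMul`, so products of $k$ such
factors cost nothing. -/
theorem norm_paravector_mul (n : ℕ) (x : E n) (a : Cl n) : ‖paravector n x * a‖ = ‖x‖ * ‖a‖ := by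
  refine (sq_eq_sq₀ (norm_nonneg _) (by positivity)).mp ?_
  rw [← clInner_self, clInner_paravector_mul, ← mul_assoc, paravectorConj_mul, ← Algebra.smul_def,
    map_smul, clInner_self, smul_eq_mul, mul_pow]

theorem norm_paravectorConj_mul (n : ℕ) (x : E n) (a : Cl n) :
    ‖paravectorConj n x * a‖ = ‖x‖ * ‖a‖ := by
  refine (sq_eq_sq₀ (norm_nonneg _) (by positivity)).mp ?_
  rw [← clInner_self, ← clInner_paravector_mul, ← mul_assoc, paravector_mul_conj,
    ← Algebra.smul_def, map_smul, LinearMap.smul_apply, clInner_self, smul_eq_mul, mul_pow]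

theorem paravector_single (n : ℕ) (i : Fin (n + 1)) :
    paravector n (EuclideanSpace.single i 1) = unit n i := by
  simp [paravector_apply]

theorem paravectorConj_single (n : ℕ) (i : Fin (n + 1)) :
    paravectorConj n (EuclideanSpace.single i 1) = unitConj n i := by
  simp [paravectorConj_apply]

/-- Multiplication of `ℝ_n` as a continuous bilinear map. -/
noncomputable def clMul (n : ℕ) : Cl n →L[ℝ] Cl n →L[ℝ] Cl n :=
  (LinearMap.mul ℝ (Cl n)).toContinuousBilinearMap

@[simp] theorem clMul_apply (n : ℕ) (a b : Cl n) : clMul n a b = a * b := rfl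

theorem norm_mul_le_clMul (n : ℕ) (a b : Cl n) : ‖a * b‖ ≤ ‖clMul n‖ * ‖a‖ * ‖b‖ :=
  (clMul n).le_opNorm₂ a b

theorem norm_fueterVar_mul_le (n : ℕ) (j : Fin n) (x : E n) (a : Cl n) :
    ‖fueterVar j x * a‖ ≤ ‖x‖ * ‖a‖ := by
  -- $z_j$ is the paravector with coordinates $x_j$ at $e_0$ and $-x_0$ at $e_j$, of squared length
  -- $x_0^2+x_j^2\le\|x\|^2$.
  let y : E n := EuclideanSpace.single 0 (x j.succ) - EuclideanSpace.single j.succ (x 0)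
  have hy : fueterVar j x = paravector n y := by
    have h1 : y = x j.succ • EuclideanSpace.single 0 1 -
        x 0 • EuclideanSpace.single j.succ (1 : ℝ) := by
      ext i; simp [y]
    rw [h1, map_sub, map_smul, map_smul, paravector_single, paravector_single, fueterVar,
      Algebra.algebraMap_eq_smul_one, unit_zero, unit_succ]
  rw [hy, norm_paravector_mul]
  refine mul_le_mul_of_nonneg_right ?_ (norm_nonneg _)
  refine (sq_le_sq₀ (norm_nonneg _) (norm_nonneg _)).mp ?_
  rw [EuclideanSpace.norm_sq_eq, EuclideanSpace.norm_sq_eq, Fin.sum_univ_succ, Fin.sum_univ_succ,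
    Finset.sum_eq_single j]
  · simp only [y, PiLp.sub_apply, PiLp.single_apply]
    simp only [if_true, Fin.succ_ne_zero, (Fin.succ_ne_zero _).symm, if_false, sub_zero, zero_sub,
      norm_neg]
    rw [add_comm]
    gcongr
    exact Finset.single_le_sum (f := fun i : Fin n => ‖x i.succ‖ ^ 2)
      (fun _ _ => by positivity) (Finset.mem_univ j)
  · intro b _ hb
    simp [y, hb]
  · simp

/-! ### Iterated partial derivatives along words -/

/-- The iterated derivative `∂_{j_k} ⋯ ∂_{j_1} f` along the word `l = (j_1, …, j_k)`. -/
noncomputable def wordDeriv {n : ℕ} (l : List (Fin n)) (f : E n → Cl n) : E n → Cl n :=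
  l.foldl (fun g j => partialDeriv j.succ g) f

@[simp] theorem wordDeriv_nil {n : ℕ} (f : E n → Cl n) : wordDeriv [] f = f := rfl

@[simp] theorem wordDeriv_cons {n : ℕ} (j : Fin n) (l : List (Fin n)) (f : E n → Cl n) :
    wordDeriv (j :: l) f = wordDeriv l (partialDeriv j.succ f) := rfl

theorem partialDeriv_eventuallyEq {n : ℕ} {f g : E n → Cl n} {x : E n} (i : Fin (n + 1))
    (h : f =ᶠ[𝓝 x] g) : partialDeriv i f =ᶠ[𝓝 x] partialDeriv i g := by
  filter_upwards [h.fderiv (𝕜 := ℝ)] with y hy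
  rw [partialDeriv, partialDeriv, hy]

theorem wordDeriv_eventuallyEq {n : ℕ} {f g : E n → Cl n} {x : E n} (l : List (Fin n))
    (h : f =ᶠ[𝓝 x] g) : wordDeriv l f =ᶠ[𝓝 x] wordDeriv l g := by
  induction l generalizing f g with
  | nil => exact h
  | cons j l ih => exact ih (partialDeriv_eventuallyEq _ h)

theorem contDiff_partialDeriv {n : ℕ} {f : E n → Cl n} (hf : ContDiff ℝ (⊤ : ℕ∞) f)
    (i : Fin (n + 1)) : ContDiff ℝ (⊤ : ℕ∞) (partialDeriv i f) :=
  (hf.fderiv_right (m := (⊤ : ℕ∞)) (by simp)).clm_apply contDiff_const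

theorem contDiff_wordDeriv {n : ℕ} {f : E n → Cl n} (hf : ContDiff ℝ (⊤ : ℕ∞) f)
    (l : List (Fin n)) : ContDiff ℝ (⊤ : ℕ∞) (wordDeriv l f) := by
  induction l generalizing f with
  | nil => exact hf
  | cons j l ih => exact ih (contDiff_partialDeriv hf _)

theorem partialDeriv_comm {n : ℕ} {f : E n → Cl n} (hf : ContDiff ℝ (⊤ : ℕ∞) f)
    (i j : Fin (n + 1)) : partialDeriv i (partialDeriv j f) = partialDeriv j (partialDeriv i f) := by
  have hd : Differentiable ℝ (fderiv ℝ f) :=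
    (hf.fderiv_right (m := (⊤ : ℕ∞)) (by simp)).differentiable (by simp)
  have h : ∀ i j x, partialDeriv i (partialDeriv j f) x =
      fderiv ℝ (fderiv ℝ f) x (EuclideanSpace.single i 1) (EuclideanSpace.single j 1) := by
    intro i j x
    have h1 : HasFDerivAt (partialDeriv j f)
        ((fderiv ℝ (fderiv ℝ f) x).flip (EuclideanSpace.single j 1)) x := by
      have := (hd x).hasFDerivAt.clm_apply (hasFDerivAt_const (EuclideanSpace.single j (1 : ℝ)) x)
      convert! this using 1
      ext v
      simp
    rw [partialDeriv, h1.fderiv]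
    rfl
  funext x
  rw [h, h]
  exact (hf.contDiffAt.isSymmSndFDerivAt
    (by simpa using WithTop.coe_le_coe.mpr (le_top : (2 : ℕ∞) ≤ ⊤))).eq _ _

theorem wordDeriv_perm {n : ℕ} {l l' : List (Fin n)} (h : l.Perm l') {f : E n → Cl n}
    (hf : ContDiff ℝ (⊤ : ℕ∞) f) : wordDeriv l f = wordDeriv l' f := by
  induction h generalizing f with
  | nil => rfl
  | cons j _ ih => exact ih (contDiff_partialDeriv hf _)
  | swap i j l => simp only [wordDeriv_cons, partialDeriv_comm hf]
  | trans _ _ ih1 ih2 => rw [ih1 hf, ih2 hf]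

/-! ### Derivatives of the Cauchy kernel -/

/-- `KernelBound n s p c g`: `g` is a combination, with coefficients of total size `c`, of
products of `|x|^{-s}` with `p - s` factors `x / |x|²`, `x̄ / |x|²` and with units. -/
inductive KernelBound (n s : ℕ) : ℕ → ℝ → (E n → Cl n) → Prop
  | base : KernelBound n s s 1 (fun x => (‖x‖ ^ 2) ^ (-(s : ℝ) / 2) • 1)
  | mul {p c g} : KernelBound n s p c g →
      KernelBound n s (p + 1) c (fun x => (‖x‖ ^ 2)⁻¹ • (paravector n x * g x))
  | conjMul {p c g} : KernelBound n s p c g →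
      KernelBound n s (p + 1) c (fun x => (‖x‖ ^ 2)⁻¹ • (paravectorConj n x * g x))
  | unitMul {p c g} (i : Fin (n + 1)) : KernelBound n s p c g →
      KernelBound n s p c (fun x => unit n i * g x)
  | unitConjMul {p c g} (i : Fin (n + 1)) : KernelBound n s p c g →
      KernelBound n s p c (fun x => unitConj n i * g x)
  | smul {p c g} (r : ℝ) : KernelBound n s p c g → KernelBound n s p (|r| * c) (fun x => r • g x)
  | add {p c c' g g'} : KernelBound n s p c g → KernelBound n s p c' g' →
      KernelBound n s p (c + c') (fun x => g x + g' x)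

theorem norm_unit_mul (n : ℕ) (i : Fin (n + 1)) (a : Cl n) : ‖unit n i * a‖ = ‖a‖ := by
  rw [← paravector_single, norm_paravector_mul]; simp

theorem norm_unitConj_mul (n : ℕ) (i : Fin (n + 1)) (a : Cl n) : ‖unitConj n i * a‖ = ‖a‖ := by
  rw [← paravectorConj_single, norm_paravectorConj_mul]; simp

theorem norm_one_cl (n : ℕ) : ‖(1 : Cl n)‖ = 1 := by
  have h := clInner_basis n ∅ ∅
  have h1 : clBasis n ∅ = 1 := by simp [clBasis_apply, unitProd]
  rw [h1, clInner_self, if_pos rfl] at h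
  exact (pow_eq_one_iff_of_nonneg (norm_nonneg _) two_ne_zero).mp h

theorem KernelBound.norm_le {n s p : ℕ} {c : ℝ} {g : E n → Cl n} (h : KernelBound n s p c g)
    {x : E n} (hx : x ≠ 0) : ‖g x‖ ≤ c * (‖x‖ ^ p)⁻¹ := by
  have hx0 : 0 < ‖x‖ := norm_pos_iff.mpr hx
  have key : ∀ (p : ℕ) (c t : ℝ), t ≤ c * (‖x‖ ^ p)⁻¹ →
      (‖x‖ ^ 2)⁻¹ * (‖x‖ * t) ≤ c * (‖x‖ ^ (p + 1))⁻¹ := by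
    intro p c t ht
    have h1 : (‖x‖ ^ 2)⁻¹ * (‖x‖ * t) = ‖x‖⁻¹ * t := by field_simp
    have h2 : c * (‖x‖ ^ (p + 1))⁻¹ = ‖x‖⁻¹ * (c * (‖x‖ ^ p)⁻¹) := by
      rw [pow_succ, mul_inv]; ring
    rw [h1, h2]
    gcongr
  induction h with
  | base =>
    rw [norm_smul, norm_one_cl, mul_one, one_mul, Real.norm_of_nonneg (by positivity),
      ← Real.rpow_natCast ‖x‖ 2, ← Real.rpow_mul hx0.le]
    rw [show ((2 : ℕ) : ℝ) * (-(s : ℝ) / 2) = -s by push_cast; ring, Real.rpow_neg hx0.le,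
      Real.rpow_natCast]
  | mul _ ih =>
    rw [norm_smul, norm_paravector_mul, Real.norm_of_nonneg (by positivity)]
    exact key _ _ _ ih
  | conjMul _ ih =>
    rw [norm_smul, norm_paravectorConj_mul, Real.norm_of_nonneg (by positivity)]
    exact key _ _ _ ih
  | unitMul i _ ih => rwa [norm_unit_mul]
  | unitConjMul i _ ih => rwa [norm_unitConj_mul]
  | smul r _ ih =>
    rw [norm_smul, Real.norm_eq_abs, mul_assoc]
    gcongr
  | add _ _ ih1 ih2 =>
    rw [add_mul]
    exact (norm_add_le _ _).trans (add_le_add ih1 ih2)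

theorem hasFDerivAt_norm_sq {n : ℕ} (x : E n) :
    HasFDerivAt (fun y : E n => ‖y‖ ^ 2) (2 • innerSL ℝ x) x :=
  (hasStrictFDerivAt_norm_sq x).hasFDerivAt

theorem hasFDerivAt_const_mul {n : ℕ} {g : E n → Cl n} {g' : E n →L[ℝ] Cl n} {x : E n} (a : Cl n)
    (h : HasFDerivAt g g' x) : HasFDerivAt (fun y => a * g y) ((clMul n a).comp g') x :=
  (clMul n a).hasFDerivAt.comp x h

/-- The derivative of `p(x) g(x) / |x|²`, where `q` is the conjugate of `p`. -/
theorem hasFDerivAt_inv_norm_sq_smul_mul {n : ℕ} {p q : E n →L[ℝ] Cl n}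
    (hpq : ∀ x y, p x * q y + p y * q x = algebraMap ℝ (Cl n) (2 * inner ℝ x y))
    (hqp : ∀ x, q x * p x = algebraMap ℝ (Cl n) (‖x‖ ^ 2))
    {g : E n → Cl n} {x : E n} (hx : x ≠ 0) (hg : DifferentiableAt ℝ g x) (v : E n) :
    DifferentiableAt ℝ (fun y => (‖y‖ ^ 2)⁻¹ • (p y * g y)) x ∧
    fderiv ℝ (fun y => (‖y‖ ^ 2)⁻¹ • (p y * g y)) x v =
      (-1 : ℝ) • ((‖x‖ ^ 2)⁻¹ • (p x * (q v * ((‖x‖ ^ 2)⁻¹ • (p x * g x))))) +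
        (‖x‖ ^ 2)⁻¹ • (p x * fderiv ℝ g x v) := by
  have hx2 : ‖x‖ ^ 2 ≠ 0 := by simpa using hx
  have h1 := (hasDerivAt_inv hx2).comp_hasFDerivAt x (hasFDerivAt_norm_sq x)
  have h2 := (clMul n).hasFDerivAt_of_bilinear (p.hasFDerivAt (x := x)) hg.hasFDerivAt
  have h3 := h1.smul h2
  refine ⟨h3.differentiableAt, ?_⟩
  have h4 : fderiv ℝ (fun y => (‖y‖ ^ 2)⁻¹ • (p y * g y)) x = _ := h3.fderiv
  rw [h4]
  simp only [add_apply, smul_apply,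
    ContinuousLinearMap.smulRight_apply, ContinuousLinearMap.precompR_apply,
    ContinuousLinearMap.precompL_apply, clMul_apply, innerSL_apply_apply, smul_eq_mul,
    Function.comp_apply, ContinuousLinearMap.compL_apply, ContinuousLinearMap.comp_apply,
    nsmul_eq_mul, Nat.cast_ofNat]
  -- Since $p/|x|^2=q^{-1}$, the claim is the rule $d(q^{-1})=-q^{-1}(dq)q^{-1}$. This identity
  -- matches it with the quotient rule.
  have h5 : p x * (q v * (p x * g x)) =
      (2 * inner ℝ x v) • (p x * g x) - (‖x‖ ^ 2) • (p v * g x) := by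
    have e1 := hpq x v
    have e2 : p x * q v = algebraMap ℝ (Cl n) (2 * inner ℝ x v) - p v * q x := by
      rw [← e1]; abel
    rw [← mul_assoc, e2, sub_mul, mul_assoc (p v), ← mul_assoc (q x), hqp, ← Algebra.smul_def,
      ← Algebra.smul_def, mul_smul_comm]
  simp only [mul_smul_comm, h5, smul_sub, smul_smul, smul_add]
  match_scalars <;> field_simp

/-- The cost is exactly $p$. The power $|x|^{-s}$ contributes $s$, because $-s\,x_i|x|^{-2}=-\frac
s2\,|x|^{-2}(\bar x e_i+\bar e_i x)$ has two terms of weight $s/2$. Each of the $p-s$ factors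
$x/|x|^2$ or $\bar x/|x|^2$ is the inverse of a paravector and contributes $1$. -/
theorem KernelBound.partialDeriv {n s p : ℕ} {c : ℝ} {g : E n → Cl n}
    (h : KernelBound n s p c g) (i : Fin (n + 1)) :
    ∃ g', KernelBound n s (p + 1) (p * c) g' ∧
      ∀ x, x ≠ 0 → DifferentiableAt ℝ g x ∧ partialDeriv i g x = g' x := by
  simp only [Monogenic.partialDeriv]
  induction h with
  | base =>
    refine ⟨fun x => (-((s : ℝ) / 2)) •
        ((‖x‖ ^ 2)⁻¹ • (paravectorConj n x * (unit n i * ((‖x‖ ^ 2) ^ (-(s : ℝ) / 2) • 1))) +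
          unitConj n i * ((‖x‖ ^ 2)⁻¹ • (paravector n x * ((‖x‖ ^ 2) ^ (-(s : ℝ) / 2) • 1)))),
      ?_, fun x hx => ?_⟩
    · have h1 : KernelBound n s s 1 (fun x => (‖x‖ ^ 2) ^ (-(s : ℝ) / 2) • 1) := KernelBound.base
      convert! ((h1.unitMul i).conjMul.add (h1.mul.unitConjMul i)).smul (-((s : ℝ) / 2)) using 1
      rw [abs_neg, abs_of_nonneg (by positivity)]
      ring
    · have hx2 : ‖x‖ ^ 2 ≠ 0 := by simpa using hx
      have h1 := ((Real.hasDerivAt_rpow_const (p := -(s : ℝ) / 2) (Or.inl hx2)).comp_hasFDerivAt x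
        (hasFDerivAt_norm_sq x)).smul_const (1 : Cl n)
      refine ⟨h1.differentiableAt, ?_⟩
      have h4 : fderiv ℝ (fun x : E n => (‖x‖ ^ 2) ^ (-(s : ℝ) / 2) • (1 : Cl n)) x = _ := h1.fderiv
      rw [h4]
      have h5 := paravectorConj_mul_add n x (EuclideanSpace.single i (1 : ℝ))
      rw [paravector_single, paravectorConj_single, Algebra.algebraMap_eq_smul_one] at h5
      simp only [mul_smul_comm, mul_one, ← smul_add, smul_comm _ ((‖x‖ ^ 2) ^ (-(s : ℝ) / 2)), h5,
        ContinuousLinearMap.smulRight_apply, smul_apply, innerSL_apply_apply, smul_smul]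
      congr 1
      rw [Real.rpow_sub_one hx2]
      simp only [smul_eq_mul, nsmul_eq_mul]
      push_cast
      field_simp
  | @mul p c g hg ih =>
    obtain ⟨g', hg', ih⟩ := ih
    have hc : ((p + 1 : ℕ) : ℝ) * c = |-1| * c + p * c := by
      rw [abs_neg, abs_one]; push_cast; ring
    refine ⟨_, by rw [hc]; exact ((hg.mul.unitConjMul i).mul.smul (-1)).add hg'.mul, fun x hx => ?_⟩
    obtain ⟨h1, h2⟩ := hasFDerivAt_inv_norm_sq_smul_mul (paravector_mul_conj_add n)
      (paravectorConj_mul n) hx (ih x hx).1 (EuclideanSpace.single i (1 : ℝ))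
    refine ⟨h1, h2.trans ?_⟩
    rw [paravectorConj_single, (ih x hx).2]
  | @conjMul p c g hg ih =>
    obtain ⟨g', hg', ih⟩ := ih
    have hc : ((p + 1 : ℕ) : ℝ) * c = |-1| * c + p * c := by
      rw [abs_neg, abs_one]; push_cast; ring
    refine ⟨_, by rw [hc]; exact ((hg.conjMul.unitMul i).conjMul.smul (-1)).add hg'.conjMul, fun x hx => ?_⟩
    obtain ⟨h1, h2⟩ := hasFDerivAt_inv_norm_sq_smul_mul (paravectorConj_mul_add n)
      (paravector_mul_conj n) hx (ih x hx).1 (EuclideanSpace.single i (1 : ℝ))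
    refine ⟨h1, h2.trans ?_⟩
    rw [paravector_single, (ih x hx).2]
  | unitMul j _ ih =>
    obtain ⟨g', hg', ih⟩ := ih
    refine ⟨_, hg'.unitMul j, fun x hx => ?_⟩
    have := hasFDerivAt_const_mul (unit n j) (ih x hx).1.hasFDerivAt
    exact ⟨this.differentiableAt, by rw [this.fderiv, ← (ih x hx).2]; rfl⟩
  | unitConjMul j _ ih =>
    obtain ⟨g', hg', ih⟩ := ih
    refine ⟨_, hg'.unitConjMul j, fun x hx => ?_⟩
    have := hasFDerivAt_const_mul (unitConj n j) (ih x hx).1.hasFDerivAt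
    exact ⟨this.differentiableAt, by rw [this.fderiv, ← (ih x hx).2]; rfl⟩
  | @smul p c g r _ ih =>
    obtain ⟨g', hg', ih⟩ := ih
    refine ⟨_, by rw [mul_left_comm]; exact hg'.smul r, fun x hx => ?_⟩
    have := (ih x hx).1.hasFDerivAt.const_smul r
    refine ⟨this.differentiableAt, ?_⟩
    have h4 : fderiv ℝ (fun x => r • g x) x = _ := this.fderiv
    rw [h4, ← (ih x hx).2]; rfl
  | @add p c c' g1 g2 _ _ ih1 ih2 =>
    obtain ⟨g1', hg1', ih1⟩ := ih1
    obtain ⟨g2', hg2', ih2⟩ := ih2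
    refine ⟨_, by rw [mul_add]; exact hg1'.add hg2', fun x hx => ?_⟩
    have := (ih1 x hx).1.hasFDerivAt.add (ih2 x hx).1.hasFDerivAt
    refine ⟨this.differentiableAt, ?_⟩
    have h4 : fderiv ℝ (fun x => g1 x + g2 x) x = _ := this.fderiv
    rw [h4, ← (ih1 x hx).2, ← (ih2 x hx).2]; rfl

/-- The degree rises by one with each derivative, so the costs multiply to $p(p+1)\cdots(p+k-1)$. -/
theorem KernelBound.wordDeriv {n s p : ℕ} {c : ℝ} {g : E n → Cl n}
    (h : KernelBound n s p c g) (l : List (Fin n)) :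
    ∃ g', KernelBound n s (p + l.length) (p.ascFactorial l.length * c) g' ∧
      ∀ x, x ≠ 0 → wordDeriv l g x = g' x := by
  induction l generalizing p c g with
  | nil => exact ⟨g, by simpa using h, fun _ _ => rfl⟩
  | cons j l ih =>
    obtain ⟨g1, hg1, e1⟩ := h.partialDeriv j.succ
    obtain ⟨g2, hg2, e2⟩ := ih hg1
    refine ⟨g2, ?_, fun x hx => ?_⟩
    · convert! hg2 using 1
      · simp; ring
      · have := Nat.succ_ascFactorial p l.length
        rw [List.length_cons, Nat.ascFactorial_succ, ← this, Nat.succ_eq_add_one]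
        push_cast; ring
    · rw [← e2 x hx, wordDeriv_cons]
      refine (wordDeriv_eventuallyEq l ?_).eq_of_nhds
      filter_upwards [isOpen_ne.mem_nhds hx] with y hy using (e1 y hy).2

/-- The Cauchy kernel `x̄ / |x|^{n+1}`. -/
noncomputable def cauchyKernel (n : ℕ) (x : E n) : Cl n :=
  (‖x‖ ^ 2) ^ (-((n : ℝ) + 1) / 2) • paravectorConj n x

theorem norm_wordDeriv_cauchyKernel_le {n : ℕ} (hn : 1 ≤ n) (l : List (Fin n)) {x : E n}
    (hx : x ≠ 0) : ‖wordDeriv l (cauchyKernel n) x‖ ≤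
      n.ascFactorial l.length * (‖x‖ ^ (n + l.length))⁻¹ := by
  obtain ⟨s, rfl⟩ : ∃ s, n = s + 1 := ⟨n - 1, by omega⟩
  -- With $s=n-1$ the kernel is $|x|^{-s}\cdot\bar x/|x|^2$, of degree $n$ and cost $1$.
  have h : KernelBound (s + 1) s (s + 1) 1 (cauchyKernel (s + 1)) := by
    convert! (KernelBound.base (n := s + 1) (s := s)).conjMul using 2 with x
    rw [mul_smul_comm, mul_one, smul_smul, cauchyKernel]
    by_cases hx : x = 0
    · simp [hx]
    · have hx2 : 0 < ‖x‖ ^ 2 := by positivity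
      rw [← Real.rpow_neg_one (‖x‖ ^ 2), ← Real.rpow_add hx2]
      congr 2
      push_cast; ring
  obtain ⟨g, hg, e⟩ := h.wordDeriv l
  rw [e x hx]
  simpa using hg.norm_le hx

open MeasureTheory

/-! ### The Cauchy–Pompeiu formula -/

/-- The regularised Cauchy kernel `x̄ / (|x|² + δ)^{(n+1)/2}`. -/
noncomputable def regKernel (n : ℕ) (δ : ℝ) (x : E n) : Cl n :=
  (‖x‖ ^ 2 + δ) ^ (-((n : ℝ) + 1) / 2) • paravectorConj n x

theorem dirac_eq_sum {n : ℕ} (f : E n → Cl n) (x : E n) :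
    dirac f x = ∑ i, unit n i * partialDeriv i f x := by
  rw [dirac, Fin.sum_univ_succ]
  simp

theorem hasFDerivAt_regKernel {n : ℕ} {δ : ℝ} (hδ : 0 < δ) (x : E n) :
    HasFDerivAt (regKernel n δ)
      ((‖x‖ ^ 2 + δ) ^ (-((n : ℝ) + 1) / 2) • paravectorConj n +
        ((-((n : ℝ) + 1) / 2 * (‖x‖ ^ 2 + δ) ^ (-((n : ℝ) + 1) / 2 - 1)) •
          (2 • innerSL ℝ x)).smulRight (paravectorConj n x)) x := by
  have hx : ‖x‖ ^ 2 + δ ≠ 0 := by positivity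
  have h1 := (Real.hasDerivAt_rpow_const (p := -((n : ℝ) + 1) / 2) (Or.inl hx)).comp_hasFDerivAt x
    ((hasFDerivAt_norm_sq x).add_const δ)
  exact h1.smul (paravectorConj n).hasFDerivAt

theorem unitConj_mul_unit (n : ℕ) (i : Fin (n + 1)) : unitConj n i * unit n i = 1 := by
  apply eq_of_add_self_eq
  rw [unitConj_mul_unit_add, if_pos rfl, one_add_one_eq_two]

/-- The terms without $\delta$ cancel because the Cauchy kernel is right monogenic off $0$. What
remains has the scaling of an approximate identity as $\delta\to0$, which spares the formula any
boundary integral or singular point. -/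
theorem sum_fderiv_regKernel_mul_unit {n : ℕ} {δ : ℝ} (hδ : 0 < δ) (x : E n) :
    ∑ i, fderiv ℝ (regKernel n δ) x (EuclideanSpace.single i 1) * unit n i =
      (((n : ℝ) + 1) * δ * (‖x‖ ^ 2 + δ) ^ (-((n : ℝ) + 3) / 2)) • (1 : Cl n) := by
  have hx : ‖x‖ ^ 2 + δ ≠ 0 := by positivity
  rw [(hasFDerivAt_regKernel hδ x).fderiv]
  have h1 : ∀ i, inner ℝ x (EuclideanSpace.single i (1 : ℝ)) = x i := by
    intro i; rw [EuclideanSpace.inner_single_right]; simp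
  simp only [add_apply, smul_apply, ContinuousLinearMap.smulRight_apply,
    paravectorConj_single, innerSL_apply_apply, add_mul, smul_mul_assoc, unitConj_mul_unit, h1,
    Finset.sum_add_distrib, Finset.sum_const, Finset.card_univ, Fintype.card_fin]
  have h2 : ∀ i, ((-((n : ℝ) + 1) / 2 * (‖x‖ ^ 2 + δ) ^ (-((n : ℝ) + 1) / 2 - 1)) • 2 • x i) •
      (paravectorConj n x * unit n i) =
      (-((n : ℝ) + 1) * (‖x‖ ^ 2 + δ) ^ (-((n : ℝ) + 1) / 2 - 1)) •
        (paravectorConj n x * (x i • unit n i)) := by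
    intro i
    rw [mul_smul_comm, smul_smul]
    congr 1
    simp only [smul_eq_mul, nsmul_eq_mul]
    push_cast; ring
  simp only [h2, ← Finset.smul_sum, ← Finset.mul_sum]
  rw [← paravector_apply, paravectorConj_mul, Algebra.algebraMap_eq_smul_one, smul_smul,
    ← Nat.cast_smul_eq_nsmul ℝ, smul_smul, ← add_smul]
  congr 1
  rw [show -((n : ℝ) + 3) / 2 = -((n : ℝ) + 1) / 2 - 1 by ring, Real.rpow_sub_one hx]
  field_simp
  push_cast; ring

theorem continuous_regKernel {n : ℕ} {δ : ℝ} (hδ : 0 < δ) : Continuous (regKernel n δ) :=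
  continuous_iff_continuousAt.mpr fun x => (hasFDerivAt_regKernel hδ x).continuousAt

theorem continuous_fderiv_regKernel_apply {n : ℕ} {δ : ℝ} (hδ : 0 < δ) (v : E n) :
    Continuous fun x => fderiv ℝ (regKernel n δ) x v := by
  have h : ∀ x : E n, ‖x‖ ^ 2 + δ ≠ 0 := fun x => by positivity
  have e : (fun x => fderiv ℝ (regKernel n δ) x v) = fun x =>
      (‖x‖ ^ 2 + δ) ^ (-((n : ℝ) + 1) / 2) • paravectorConj n v +
        ((-((n : ℝ) + 1) / 2 * (‖x‖ ^ 2 + δ) ^ (-((n : ℝ) + 1) / 2 - 1)) *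
          (2 * inner ℝ x v)) • (paravectorConj n x) := by
    funext x
    rw [(hasFDerivAt_regKernel hδ x).fderiv]
    simp
  rw [e]
  have h1 : ∀ a : ℝ, Continuous fun x : E n => (‖x‖ ^ 2 + δ) ^ a := fun a =>
    (by fun_prop : Continuous fun x : E n => ‖x‖ ^ 2 + δ).rpow_const fun x => Or.inl (h x)
  have h2 := h1 (-((n : ℝ) + 1) / 2)
  have h3 := h1 (-((n : ℝ) + 1) / 2 - 1)
  fun_prop

theorem continuous_mul_cl {n : ℕ} {X : Type*} [TopologicalSpace X] {f g : X → Cl n}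
    (hf : Continuous f) (hg : Continuous g) : Continuous fun x => f x * g x :=
  ((clMul n).continuous.comp hf).clm_apply hg

/-- Integration by parts in each coordinate, with $e_i$ kept between the kernel and $g$ because the
algebra is not commutative. The sign from the integration by parts cancels the one from
differentiating $y\mapsto x-y$. -/
theorem integral_regKernel_mul_dirac {n : ℕ} {δ : ℝ} (hδ : 0 < δ) {g : E n → Cl n}
    (hg : ContDiff ℝ 1 g) (hc : HasCompactSupport g) (x : E n) :
    ∫ y, regKernel n δ (x - y) * dirac g y =
      ∫ y, (((n : ℝ) + 1) * δ * (‖x - y‖ ^ 2 + δ) ^ (-((n : ℝ) + 3) / 2)) • g y := by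
  let B : Fin (n + 1) → Cl n →L[ℝ] Cl n →L[ℝ] Cl n := fun i =>
    (clMul n).comp ((clMul n).flip (unit n i))
  have hsub : Continuous fun y : E n => x - y := by fun_prop
  have hdg : ∀ i : Fin (n + 1), Continuous fun y => fderiv ℝ g y (EuclideanSpace.single i 1) :=
    fun i => (hg.continuous_fderiv one_ne_zero).clm_apply continuous_const
  have hK : ∀ y, HasFDerivAt (fun y => regKernel n δ (x - y))
      (-(fderiv ℝ (regKernel n δ) (x - y))) y := by
    intro y
    have h1 := (hasFDerivAt_regKernel hδ (x - y)).differentiableAt.hasFDerivAt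
    have h2 := h1.comp y ((hasFDerivAt_id y).const_sub x)
    convert! h2 using 1
    ext v; simp
  have hBi : ∀ i (a b : Cl n), B i a b = a * unit n i * b := fun i a b => rfl
  have hcs : ∀ (u : E n → Cl n) (w : E n → Cl n), HasCompactSupport w →
      HasCompactSupport fun y => u y * w y := by
    intro u w hw
    refine hw.mono fun y hy => ?_
    simp only [Function.mem_support] at hy ⊢
    intro h0; exact hy (by rw [h0, mul_zero])
  have hcd : ∀ i : Fin (n + 1), HasCompactSupport fun y =>
      fderiv ℝ g y (EuclideanSpace.single i 1) := fun i => by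
    refine (hc.fderiv ℝ).mono fun y hy => ?_
    simp only [Function.mem_support] at hy ⊢
    intro h0; exact hy (by rw [h0]; rfl)
  have i1 : ∀ i, Integrable fun y =>
      (fderiv ℝ (regKernel n δ) (x - y) (EuclideanSpace.single i 1) * unit n i) * g y := fun i =>
    (continuous_mul_cl (continuous_mul_cl ((continuous_fderiv_regKernel_apply hδ _).comp hsub)
      continuous_const) hg.continuous).integrable_of_hasCompactSupport (hcs _ _ hc)
  have i2 : ∀ i, Integrable fun y =>
      (regKernel n δ (x - y) * unit n i) * fderiv ℝ g y (EuclideanSpace.single i 1) := fun i =>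
    (continuous_mul_cl (continuous_mul_cl ((continuous_regKernel hδ).comp hsub)
      continuous_const) (hdg i)).integrable_of_hasCompactSupport (hcs _ _ (hcd i))
  have i3 : ∀ i, Integrable fun y => (regKernel n δ (x - y) * unit n i) * g y := fun i =>
    (continuous_mul_cl (continuous_mul_cl ((continuous_regKernel hδ).comp hsub)
      continuous_const) hg.continuous).integrable_of_hasCompactSupport (hcs _ _ hc)
  have key : ∀ i, ∫ y, (regKernel n δ (x - y) * unit n i) *
      fderiv ℝ g y (EuclideanSpace.single i 1) =
      ∫ y, (fderiv ℝ (regKernel n δ) (x - y) (EuclideanSpace.single i 1) * unit n i) * g y := by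
    intro i
    have := integral_bilinear_hasFDerivAt_right_eq_neg_left_of_integrable (B := B i)
      (f := fun y => regKernel n δ (x - y)) (f' := fun y => -(fderiv ℝ (regKernel n δ) (x - y)))
      (g := g) (g' := fderiv ℝ g) (v := EuclideanSpace.single i (1 : ℝ)) (μ := volume)
      (by simpa [hBi] using (i1 i).neg) (by simpa [hBi] using i2 i) (by simpa [hBi] using i3 i)
      (fun y _ => hK y) (fun y _ => (hg.differentiable one_ne_zero y).hasFDerivAt)
    simp only [hBi] at this
    rw [this, ← integral_neg]
    congr 1
    funext y
    simp
  have e1 : (fun y => regKernel n δ (x - y) * dirac g y) = fun y =>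
      ∑ i, (regKernel n δ (x - y) * unit n i) * fderiv ℝ g y (EuclideanSpace.single i 1) := by
    funext y
    rw [dirac_eq_sum, Finset.mul_sum]
    simp only [mul_assoc, partialDeriv]
  have e2 : (fun y => (((n : ℝ) + 1) * δ * (‖x - y‖ ^ 2 + δ) ^ (-((n : ℝ) + 3) / 2)) • g y) =
      fun y => ∑ i, (fderiv ℝ (regKernel n δ) (x - y) (EuclideanSpace.single i 1) * unit n i) *
        g y := by
    funext y
    rw [← Finset.sum_mul, sum_fderiv_regKernel_mul_unit hδ, smul_mul_assoc, one_mul]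
  rw [e1, e2, integral_finsetSum _ fun i _ => i2 i, integral_finsetSum _ fun i _ => i1 i]
  exact Finset.sum_congr rfl fun i _ => key i

/-- The total mass of the approximate identity `(n+1) (1 + |x|²)^{-(n+3)/2}`. -/
noncomputable def pompeiuConst (n : ℕ) : ℝ :=
  ∫ x : E n, ((n : ℝ) + 1) * (1 + ‖x‖ ^ 2) ^ (-((n : ℝ) + 3) / 2)

theorem integrable_pompeiu (n : ℕ) :
    Integrable fun x : E n => ((n : ℝ) + 1) * (1 + ‖x‖ ^ 2) ^ (-((n : ℝ) + 3) / 2) :=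
  (integrable_rpow_neg_one_add_norm_sq (by simp)).const_mul _

theorem pompeiuConst_pos (n : ℕ) : 0 < pompeiuConst n := by
  refine integral_pos_of_integrable_nonneg_nonzero (x := 0) ?_ (integrable_pompeiu n)
    (fun x => by positivity) ?_
  · refine continuous_const.mul ?_
    exact (by fun_prop : Continuous fun x : E n => 1 + ‖x‖ ^ 2).rpow_const
      fun x => Or.inl (by positivity)
  · simp only [norm_zero]; positivity

/-- For $\delta=c^{-2}$ the density of the preceding formula is $c^{n+1}\psi(c(x-y))$ with $\psi$
integrable of total mass `pompeiuConst n`; its decay of order $n+3$ suffices for convergence at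
points of continuity. -/
theorem tendsto_integral_regKernel {n : ℕ} {g : E n → Cl n} (hg : ContDiff ℝ 1 g)
    (hc : HasCompactSupport g) (x : E n) :
    Tendsto (fun c : ℝ => ∫ y, regKernel n ((c ^ 2)⁻¹) (x - y) * dirac g y) atTop
      (𝓝 (pompeiuConst n • g x)) := by
  have hκ := pompeiuConst_pos n
  let φ : E n → ℝ := fun z =>
    (pompeiuConst n)⁻¹ * (((n : ℝ) + 1) * (1 + ‖z‖ ^ 2) ^ (-((n : ℝ) + 3) / 2))
  have h1 : ∫ z, φ z = 1 := by
    rw [integral_const_mul]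
    exact inv_mul_cancel₀ hκ.ne'
  have h2 : Tendsto (fun z : E n => ‖z‖ ^ Module.finrank ℝ (E n) * φ z) (Bornology.cobounded (E n))
      (𝓝 0) := by
    have h3 : Tendsto (fun z : E n => ((pompeiuConst n)⁻¹ * ((n : ℝ) + 1)) * (‖z‖ ^ 2)⁻¹)
        (Bornology.cobounded (E n)) (𝓝 0) := by
      rw [← mul_zero ((pompeiuConst n)⁻¹ * ((n : ℝ) + 1))]
      exact ((tendsto_inv_atTop_zero.comp (tendsto_pow_atTop two_ne_zero)).comp
        tendsto_norm_cobounded_atTop).const_mul _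
    refine squeeze_zero' (Eventually.of_forall fun z => by positivity) ?_ h3
    filter_upwards [tendsto_norm_cobounded_atTop.eventually_gt_atTop 0] with z hz
    have h4 : (1 + ‖z‖ ^ 2) ^ (-((n : ℝ) + 3) / 2) ≤ (‖z‖ ^ (n + 3))⁻¹ := by
      rw [← Real.rpow_natCast ‖z‖ (n + 3), ← Real.rpow_neg hz.le]
      have : (‖z‖ : ℝ) ^ (-((n + 3 : ℕ) : ℝ)) = (‖z‖ ^ 2) ^ (-((n : ℝ) + 3) / 2) := by
        rw [← Real.rpow_natCast ‖z‖ 2, ← Real.rpow_mul hz.le]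
        congr 1; push_cast; ring
      rw [this]
      refine Real.rpow_le_rpow_of_nonpos (by positivity) (by linarith) ?_
      rw [neg_div]; simp; positivity
    have hd : Module.finrank ℝ (E n) = n + 1 := by simp
    rw [hd]
    calc ‖z‖ ^ (n + 1) * φ z ≤ ‖z‖ ^ (n + 1) * ((pompeiuConst n)⁻¹ * (((n : ℝ) + 1) *
          (‖z‖ ^ (n + 3))⁻¹)) := by
          simp only [φ]; gcongr
      _ = _ := by field_simp; ring
  have h5 := tendsto_integral_comp_smul_smul_of_integrable' (μ := volume) (φ := φ)
    (fun z => by positivity) h1 h2 (x₀ := x)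
    (hg.continuous.integrable_of_hasCompactSupport hc) hg.continuous.continuousAt
  refine (h5.const_smul (pompeiuConst n)).congr' ?_
  filter_upwards [eventually_gt_atTop 0] with c hc0
  rw [integral_regKernel_mul_dirac (by positivity) hg hc, ← integral_smul]
  congr 1
  funext y
  rw [smul_smul]
  congr 1
  have hd : Module.finrank ℝ (E n) = n + 1 := by simp
  simp only [φ]
  rw [hd, norm_smul, Real.norm_of_nonneg hc0.le]
  have h6 : ‖x - y‖ ^ 2 + (c ^ 2)⁻¹ = (1 + (c * ‖x - y‖) ^ 2) * (c ^ 2)⁻¹ := by field_simp; ring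
  have h7 : ((c ^ 2)⁻¹ : ℝ) ^ (-((n : ℝ) + 3) / 2) = c ^ (n + 3) := by
    rw [← Real.rpow_natCast c 2, ← Real.rpow_neg hc0.le, ← Real.rpow_mul hc0.le,
      ← Real.rpow_natCast c (n + 3)]
    congr 1; push_cast; ring
  rw [h6, Real.mul_rpow (by positivity) (by positivity), h7]
  field_simp
  ring

/-! ### Smoothness and Cauchy estimates -/

/-- The bound is uniform in $\delta$, so it serves as the dominating function when $\delta\to0$ away
from the singularity. -/
theorem norm_regKernel_mul_le {n : ℕ} {δ : ℝ} (hδ : 0 ≤ δ) {x : E n} (hx : 1 / 2 ≤ ‖x‖) (a : Cl n) :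
    ‖regKernel n δ x * a‖ ≤ (1 / 4) ^ (-((n : ℝ) + 1) / 2) * (‖x‖ * ‖a‖) := by
  rw [regKernel, smul_mul_assoc, norm_smul, norm_paravectorConj_mul,
    Real.norm_of_nonneg (by positivity)]
  refine mul_le_mul_of_nonneg_right ?_ (by positivity)
  refine Real.rpow_le_rpow_of_nonpos (by norm_num) ?_ ?_
  · nlinarith
  · have : (0 : ℝ) ≤ n := Nat.cast_nonneg n
    linarith

theorem continuous_partialDeriv {n : ℕ} {f : E n → Cl n} (hf : ContDiff ℝ 1 f)
    (i : Fin (n + 1)) : Continuous (partialDeriv i f) :=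
  (hf.continuous_fderiv one_ne_zero).clm_apply continuous_const

theorem continuous_dirac {n : ℕ} {f : E n → Cl n} (hf : ContDiff ℝ 1 f) :
    Continuous (dirac f) := by
  have e : dirac f = fun x => ∑ i, unit n i * partialDeriv i f x := funext (dirac_eq_sum f)
  rw [e]
  exact continuous_finsetSum _ fun i _ =>
    continuous_mul_cl continuous_const (continuous_partialDeriv hf i)

theorem hasCompactSupport_dirac {n : ℕ} {f : E n → Cl n} (hf : HasCompactSupport f) :
    HasCompactSupport (dirac f) := by
  refine (hf.fderiv ℝ).mono fun y hy => ?_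
  simp only [Function.mem_support] at hy ⊢
  intro h0
  exact hy (by simp [dirac, partialDeriv, h0])

/-- The Cauchy–Pompeiu formula at a point off the support of `𝒟 g`. -/
theorem smul_eq_integral_cauchyKernel {n : ℕ} {g : E n → Cl n} (hg : ContDiff ℝ 1 g)
    (hc : HasCompactSupport g) {x : E n} (hx : ‖x‖ < 1 / 2)
    (h0 : ∀ y, ‖y‖ < 1 → dirac g y = 0) :
    pompeiuConst n • g x = ∫ y, cauchyKernel n (x - y) * dirac g y := by
  refine tendsto_nhds_unique (tendsto_integral_regKernel hg hc x) ?_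
  have hsub : Continuous fun y : E n => x - y := by fun_prop
  have hdist : ∀ y, dirac g y ≠ 0 → 1 / 2 ≤ ‖x - y‖ := by
    intro y hy
    have h1 : 1 ≤ ‖y‖ := by
      by_contra h; exact hy (h0 y (not_le.mp h))
    have := norm_sub_norm_le y x
    rw [norm_sub_rev] at this
    linarith
  refine tendsto_integral_filter_of_dominated_convergence
    (fun y => (1 / 4) ^ (-((n : ℝ) + 1) / 2) * (‖x - y‖ * ‖dirac g y‖)) ?_ ?_ ?_ ?_
  · filter_upwards [eventually_gt_atTop 0] with c hc0
    exact (continuous_mul_cl ((continuous_regKernel (by positivity)).comp hsub)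
      (continuous_dirac hg)).aestronglyMeasurable
  · filter_upwards [eventually_gt_atTop 0] with c hc0
    refine Eventually.of_forall fun y => ?_
    by_cases hy : dirac g y = 0
    · simp [hy]
    · exact norm_regKernel_mul_le (by positivity) (hdist y hy) _
  · refine Continuous.integrable_of_hasCompactSupport ?_ ?_
    · have := continuous_dirac hg
      fun_prop
    · refine (hasCompactSupport_dirac hc).mono fun y hy => ?_
      simp only [Function.mem_support] at hy ⊢
      intro h0; exact hy (by simp [h0])
  · refine Eventually.of_forall fun y => ?_
    by_cases hy : dirac g y = 0
    · simp [hy]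
    · have hp : 0 < ‖x - y‖ := by linarith [hdist y hy]
      have h1 : Tendsto (fun c : ℝ => ‖x - y‖ ^ 2 + (c ^ 2)⁻¹) atTop (𝓝 (‖x - y‖ ^ 2)) := by
        have := (tendsto_inv_atTop_zero.comp (tendsto_pow_atTop (α := ℝ) two_ne_zero)).const_add
          (‖x - y‖ ^ 2)
        simpa using this
      have h2 := h1.rpow_const (p := -((n : ℝ) + 1) / 2) (Or.inl (by positivity))
      have h3 := (h2.smul_const (paravectorConj n (x - y)))
      exact ((clMul n).flip (dirac g y)).continuous.continuousAt.tendsto.comp h3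

theorem contDiffAt_cauchyKernel {n : ℕ} {x : E n} (hx : x ≠ 0) :
    ContDiffAt ℝ (⊤ : ℕ∞) (cauchyKernel n) x := by
  have hx2 : ‖x‖ ^ 2 ≠ 0 := by simpa using hx
  exact ((contDiff_norm_sq ℝ).contDiffAt.rpow_const_of_ne hx2).smul
    (paravectorConj n).contDiff.contDiffAt

/-- A compactly supported smooth function agreeing with the Cauchy kernel on `1/4 < |x| < 3`. -/
theorem exists_cutoff_cauchyKernel (n : ℕ) : ∃ K : E n → Cl n, ContDiff ℝ (⊤ : ℕ∞) K ∧
    HasCompactSupport K ∧ ∀ x : E n, 1 / 4 < ‖x‖ → ‖x‖ < 3 → K x = cauchyKernel n x := by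
  let b₁ : ContDiffBump (0 : E n) := ⟨3, 4, by norm_num, by norm_num⟩
  let b₂ : ContDiffBump (0 : E n) := ⟨1 / 8, 1 / 4, by norm_num, by norm_num⟩
  refine ⟨fun x => (b₁ x * (1 - b₂ x)) • cauchyKernel n x, ?_, ?_, ?_⟩
  · rw [contDiff_iff_contDiffAt]
    intro x
    by_cases hx : x = 0
    · subst hx
      refine contDiffAt_const (c := (0 : Cl n)) |>.congr_of_eventuallyEq ?_
      filter_upwards [b₂.eventuallyEq_one] with y hy
      simp [hy]
    · exact (b₁.contDiffAt.mul (contDiffAt_const.sub b₂.contDiffAt)).smul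
        (contDiffAt_cauchyKernel hx)
  · refine b₁.hasCompactSupport.mono fun y hy => ?_
    simp only [Function.mem_support] at hy ⊢
    intro h0; exact hy (by simp [h0])
  · intro x h1 h2
    have e1 : b₁ x = 1 := b₁.one_of_mem_closedBall (by simpa using h2.le)
    have e2 : b₂ x = 0 := b₂.zero_of_le_dist (by rw [dist_zero_right]; exact h1.le)
    simp [e1, e2]

/-- Convolution with a kernel acting by left multiplication. -/
noncomputable def kernelConv {n : ℕ} (K G : E n → Cl n) : E n → Cl n :=
  convolution G K (clMul n).flip volume

theorem kernelConv_apply {n : ℕ} (K G : E n → Cl n) (x : E n) :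
    kernelConv K G x = ∫ y, K (x - y) * G y := rfl

theorem partialDeriv_kernelConv {n : ℕ} {K G : E n → Cl n} (hK : ContDiff ℝ (⊤ : ℕ∞) K)
    (hc : HasCompactSupport K) (hG : Continuous G) (i : Fin (n + 1)) :
    partialDeriv i (kernelConv K G) = kernelConv (partialDeriv i K) G := by
  funext x
  have h1 : ContDiff ℝ 1 K := hK.of_le (by simp)
  have h := hc.hasFDerivAt_convolution_right (clMul n).flip (μ := volume)
    hG.locallyIntegrable h1 x
  have h2 : partialDeriv i (kernelConv K G) x = _ :=
    congrArg (fun L => L (EuclideanSpace.single i (1 : ℝ))) h.fderiv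
  rw [h2, convolution_precompR_apply _ hG.locallyIntegrable (hc.fderiv ℝ)
    (h1.continuous_fderiv one_ne_zero)]
  rfl

theorem hasCompactSupport_partialDeriv {n : ℕ} {K : E n → Cl n} (hc : HasCompactSupport K)
    (i : Fin (n + 1)) : HasCompactSupport (partialDeriv i K) := by
  refine (hc.fderiv ℝ).mono fun y hy => ?_
  simp only [Function.mem_support] at hy ⊢
  intro h0
  exact hy (by simp [partialDeriv, h0])

theorem wordDeriv_kernelConv {n : ℕ} {K G : E n → Cl n} (hK : ContDiff ℝ (⊤ : ℕ∞) K)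
    (hc : HasCompactSupport K) (hG : Continuous G) (l : List (Fin n)) :
    wordDeriv l (kernelConv K G) = kernelConv (wordDeriv l K) G := by
  induction l generalizing K with
  | nil => rfl
  | cons j l ih =>
    rw [wordDeriv_cons, partialDeriv_kernelConv hK hc hG, ih (contDiff_partialDeriv hK _)
      (hasCompactSupport_partialDeriv hc _), wordDeriv_cons]

theorem dirac_smul {n : ℕ} {χ : E n → ℝ} {f : E n → Cl n} (hχ : Differentiable ℝ χ)
    (hf : IsMonogenic f) (x : E n) : dirac (fun y => χ y • f y) x =
      ∑ i, fderiv ℝ χ x (EuclideanSpace.single i 1) • (unit n i * f x) := by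
  have h : ∀ i, partialDeriv i (fun y => χ y • f y) x =
      χ x • partialDeriv i f x + fderiv ℝ χ x (EuclideanSpace.single i 1) • f x := by
    intro i
    have h1 := (hχ x).hasFDerivAt.smul (hf.1.differentiable one_ne_zero x).hasFDerivAt
    have h2 : fderiv ℝ (fun y => χ y • f y) x = _ := h1.fderiv
    rw [partialDeriv, h2]
    rfl
  have h3 := hf.2 x
  rw [dirac_eq_sum] at h3
  simp only [dirac_eq_sum, h, mul_add, mul_smul_comm, Finset.sum_add_distrib, ← Finset.smul_sum,
    h3, smul_zero, zero_add]

/-- Cauchy–Pompeiu is applied to $\chi f$, where $\chi=1$ on the unit ball and $\chi=0$ outside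
radius $1+\delta$. Then $\mathcal D(\chi f)=\sum_i\partial_i\chi\,e_if$ lives on the shell
$1\le\|y\|\le1+\delta$, away from the points near $0$ at which $f$ is represented, so all
derivatives fall on the kernel. The constant involves only $\chi$, not $f$ or the length of the
word. -/
theorem exists_cauchy_estimate_ball {n : ℕ} (hn : 1 ≤ n) {δ : ℝ} (hδ : 0 < δ) (hδ1 : δ ≤ 1) :
    ∃ C : ℝ, 0 ≤ C ∧ ∀ f : E n → Cl n, IsMonogenic f →
      (∃ g : E n → Cl n, ContDiff ℝ (⊤ : ℕ∞) g ∧ f =ᶠ[𝓝 0] g) ∧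
      ∀ M : ℝ, (∀ y : E n, ‖y‖ ≤ 1 + δ → ‖f y‖ ≤ M) → ∀ l : List (Fin n),
        ‖wordDeriv l f 0‖ ≤ C * n.ascFactorial l.length * M := by
  have hκ := pompeiuConst_pos n
  let χ : ContDiffBump (0 : E n) := ⟨1, 1 + δ, one_pos, by linarith⟩
  have hχ : ContDiff ℝ 1 χ := χ.contDiff
  obtain ⟨K, hK, hKc, hKE⟩ := exists_cutoff_cauchyKernel n
  let H : E n → ℝ := fun y => ∑ i : Fin (n + 1), ‖fderiv ℝ χ y (EuclideanSpace.single i 1)‖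
  have hHcont : Continuous H := continuous_finsetSum _ fun i _ =>
    ((hχ.continuous_fderiv one_ne_zero).clm_apply continuous_const).norm
  have hHsupp : ∀ y, H y ≠ 0 → fderiv ℝ χ y ≠ 0 := by
    intro y hy h0
    exact hy (by simp [H, h0])
  have hHc : HasCompactSupport H := (χ.hasCompactSupport.fderiv ℝ).mono fun y hy => hHsupp y hy
  have hout : ∀ y, fderiv ℝ χ y ≠ 0 → ‖y‖ ≤ 1 + δ := by
    intro y hy
    have h1 : y ∈ tsupport χ := support_fderiv_subset ℝ (f := χ) hy
    rw [χ.tsupport_eq] at h1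
    simpa using h1
  have hin : ∀ y : E n, ‖y‖ < 1 → fderiv ℝ χ y = 0 := by
    intro y hy
    have h1 := χ.eventuallyEq_one_of_mem_ball (x := y) (by simpa using hy)
    rw [h1.fderiv_eq]
    simp
  refine ⟨(pompeiuConst n)⁻¹ * (‖clMul n‖ * ∫ y, H y), ?_, fun f hf => ?_⟩
  · have : 0 ≤ ∫ y, H y := integral_nonneg fun y => by positivity
    positivity
  let g : E n → Cl n := fun y => χ y • f y
  have hg : ContDiff ℝ 1 g := hχ.smul hf.1
  have hgc : HasCompactSupport g := χ.hasCompactSupport.mono fun y hy => by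
    simp only [Function.mem_support] at hy ⊢
    intro h0; exact hy (by simp [g, h0])
  have hdg : ∀ y, dirac g y = ∑ i, fderiv ℝ χ y (EuclideanSpace.single i 1) • (unit n i * f y) :=
    fun y => dirac_smul (hχ.differentiable one_ne_zero) hf y
  have hd0 : ∀ y, fderiv ℝ χ y = 0 → dirac g y = 0 := by
    intro y hy; rw [hdg, hy]; simp
  have hdle : ∀ y, ‖dirac g y‖ ≤ H y * ‖f y‖ := by
    intro y
    rw [hdg, Finset.sum_mul]
    refine (norm_sum_le _ _).trans (Finset.sum_le_sum fun i _ => ?_)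
    rw [norm_smul, norm_unit_mul]
  -- On this range of $x-y$ the compactly supported smooth kernel $K$ equals the Cauchy kernel, so
  -- differentiation of convolutions applies.
  have hrange : ∀ x y : E n, ‖x‖ < 1 / 2 → dirac g y ≠ 0 → 1 / 4 < ‖x - y‖ ∧ ‖x - y‖ < 3 := by
    intro x y hx hy
    have h1 : 1 ≤ ‖y‖ := by
      by_contra h; exact hy (hd0 y (hin y (not_le.mp h)))
    have h2 := hout y fun h => hy (hd0 y h)
    have h3 := norm_sub_norm_le y x
    have h4 := norm_sub_le x y
    rw [norm_sub_rev] at h3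
    constructor <;> linarith
  have hconv : ∀ x : E n, ‖x‖ < 1 / 2 → f x = (pompeiuConst n)⁻¹ • kernelConv K (dirac g) x := by
    intro x hx
    have h1 := smul_eq_integral_cauchyKernel hg hgc hx fun y hy => hd0 y (hin y hy)
    have h2 : g x = f x := by
      have : χ x = 1 := χ.one_of_mem_closedBall (by
        simp only [mem_closedBall_zero_iff]; exact hx.le.trans (by norm_num))
      simp [g, this]
    have h3 : kernelConv K (dirac g) x = ∫ y, cauchyKernel n (x - y) * dirac g y := by
      rw [kernelConv_apply]
      congr 1
      funext y
      by_cases hy : dirac g y = 0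
      · simp [hy]
      · rw [hKE _ (hrange x y hx hy).1 (hrange x y hx hy).2]
    rw [h3, ← h1, h2, smul_smul, inv_mul_cancel₀ hκ.ne', one_smul]
  have hev : f =ᶠ[𝓝 0] fun x => (pompeiuConst n)⁻¹ • kernelConv K (dirac g) x := by
    filter_upwards [Metric.ball_mem_nhds (0 : E n) (by norm_num : (0 : ℝ) < 1 / 2)] with x hx
    exact hconv x (by simpa using hx)
  have hdc := continuous_dirac hg
  have hcd : ContDiff ℝ (⊤ : ℕ∞) (kernelConv K (dirac g)) :=
    hKc.contDiff_convolution_right _ hdc.locallyIntegrable hK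
  refine ⟨⟨_, hcd.const_smul _, hev⟩, fun M hM l => ?_⟩
  have hscal : ∀ (r : ℝ) (l : List (Fin n)) (u : E n → Cl n), ContDiff ℝ (⊤ : ℕ∞) u →
      wordDeriv l (fun x => r • u x) = fun x => r • wordDeriv l u x := by
    intro r l
    induction l with
    | nil => intro u _; rfl
    | cons j l ih =>
      intro u hu
      rw [wordDeriv_cons, wordDeriv_cons, ← ih _ (contDiff_partialDeriv hu _)]
      congr 1
      funext x
      have h1 := (hu.differentiable (by simp) x).hasFDerivAt.const_smul r
      have h2 : fderiv ℝ (fun x => r • u x) x = _ := h1.fderiv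
      rw [partialDeriv, h2]
      rfl
  -- The two kernels agree on an open set around $-y$, hence so do their derivatives.
  have hE : ∀ y, dirac g y ≠ 0 → wordDeriv l K (0 - y) = wordDeriv l (cauchyKernel n) (0 - y) := by
    intro y hy
    have h1 := hrange 0 y (by simp) hy
    refine (wordDeriv_eventuallyEq l ?_).eq_of_nhds
    have ho : IsOpen {z : E n | 1 / 4 < ‖z‖ ∧ ‖z‖ < 3} :=
      (isOpen_lt continuous_const continuous_norm).inter
        (isOpen_lt continuous_norm continuous_const)
    filter_upwards [ho.mem_nhds h1] with z hz using hKE z hz.1 hz.2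
  have hM0 : 0 ≤ M := (norm_nonneg _).trans (hM 0 (by simp; linarith))
  rw [(wordDeriv_eventuallyEq l hev).eq_of_nhds, hscal _ _ _ hcd, wordDeriv_kernelConv hK hKc hdc,
    norm_smul, kernelConv_apply, Real.norm_of_nonneg (by positivity)]
  have hb : ∀ y, ‖wordDeriv l K (0 - y) * dirac g y‖ ≤
      (‖clMul n‖ * n.ascFactorial l.length * M) * H y := by
    intro y
    by_cases hy : dirac g y = 0
    · rw [hy, mul_zero, norm_zero]; positivity
    have hy1 : 1 ≤ ‖y‖ := by
      by_contra h; exact hy (hd0 y (hin y (not_le.mp h)))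
    have hy2 := hout y fun h => hy (hd0 y h)
    have hy0 : (0 - y) ≠ 0 := by
      rw [zero_sub, neg_ne_zero]; rintro rfl; simp at hy1; linarith
    -- The shell begins at radius exactly $1$, so $\|y\|^{-(n+k)}\le1$ and no geometric factor in
    -- $k$ appears.
    have h1 : ‖wordDeriv l K (0 - y)‖ ≤ n.ascFactorial l.length := by
      rw [hE y hy]
      refine (norm_wordDeriv_cauchyKernel_le hn l hy0).trans ?_
      refine mul_le_of_le_one_right (by positivity) (inv_le_one_of_one_le₀ ?_)
      rw [zero_sub, norm_neg]
      exact one_le_pow₀ hy1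
    calc _ ≤ ‖clMul n‖ * ‖wordDeriv l K (0 - y)‖ * ‖dirac g y‖ := norm_mul_le_clMul n _ _
      _ ≤ ‖clMul n‖ * n.ascFactorial l.length * (H y * M) := by
        gcongr
        exact (hdle y).trans (mul_le_mul_of_nonneg_left (hM y hy2) (by positivity))
      _ = _ := by ring
  have hint := norm_integral_le_of_norm_le (μ := volume)
    ((hHcont.integrable_of_hasCompactSupport hHc).const_mul
      (‖clMul n‖ * n.ascFactorial l.length * M)) (Eventually.of_forall hb)
  rw [integral_const_mul] at hint
  calc _ ≤ (pompeiuConst n)⁻¹ * ((‖clMul n‖ * n.ascFactorial l.length * M) * ∫ y, H y) := by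
        gcongr
    _ = _ := by ring

/-- Rescaling and translation. -/
theorem partialDeriv_comp_affine {n : ℕ} {f : E n → Cl n} (hf : ContDiff ℝ 1 f) (p : E n) (r : ℝ)
    (i : Fin (n + 1)) (x : E n) : partialDeriv i (fun y => f (p + r • y)) x =
      r • partialDeriv i f (p + r • x) := by
  have h1 : HasFDerivAt (fun y : E n => p + r • y) (r • ContinuousLinearMap.id ℝ (E n)) x :=
    ((hasFDerivAt_id x).const_smul r).const_add p
  have h2 := (hf.differentiable one_ne_zero (p + r • x)).hasFDerivAt.comp x h1
  have h3 : fderiv ℝ (fun y => f (p + r • y)) x = _ := h2.fderiv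
  rw [partialDeriv, h3]
  simp [partialDeriv]

theorem IsMonogenic.comp_affine {n : ℕ} {f : E n → Cl n} (hf : IsMonogenic f) (p : E n) (r : ℝ) :
    IsMonogenic fun y => f (p + r • y) := by
  refine ⟨hf.1.comp (by fun_prop : ContDiff ℝ 1 fun y : E n => p + r • y), fun x => ?_⟩
  have h := hf.2 (p + r • x)
  rw [dirac_eq_sum] at h ⊢
  simp only [partialDeriv_comp_affine hf.1, mul_smul_comm, ← Finset.smul_sum, h, smul_zero]

/-- Near $0$ the function equals a smooth convolution; translation carries this to every point. -/
theorem IsMonogenic.contDiff {n : ℕ} (hn : 1 ≤ n) {f : E n → Cl n} (hf : IsMonogenic f) :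
    ContDiff ℝ (⊤ : ℕ∞) f := by
  obtain ⟨C, -, h⟩ := exists_cauchy_estimate_ball hn one_pos le_rfl
  rw [contDiff_iff_contDiffAt]
  intro p
  obtain ⟨⟨g, hg, e⟩, -⟩ := h _ (hf.comp_affine p 1)
  have h1 : ContDiff ℝ (⊤ : ℕ∞) fun x => g (x - p) := hg.comp (contDiff_id.sub contDiff_const)
  refine h1.contDiffAt.congr_of_eventuallyEq ?_
  have h2 : Tendsto (fun x : E n => x - p) (𝓝 p) (𝓝 0) := by
    rw [← sub_self p]
    exact (continuous_id.sub continuous_const).tendsto p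
  filter_upwards [h2.eventually e] with x hx
  rw [← hx]
  simp

theorem wordDeriv_comp_affine {n : ℕ} {f : E n → Cl n} (hf : ContDiff ℝ (⊤ : ℕ∞) f) (p : E n)
    (r : ℝ) (l : List (Fin n)) (x : E n) : wordDeriv l (fun y => f (p + r • y)) x =
      r ^ l.length • wordDeriv l f (p + r • x) := by
  -- The scalar $c$ collects the powers of $r$ along the induction.
  suffices h : ∀ (c : ℝ), wordDeriv l (fun y => c • f (p + r • y)) x =
      (c * r ^ l.length) • wordDeriv l f (p + r • x) by simpa using h 1
  induction l generalizing f with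
  | nil => intro c; simp
  | cons j l ih =>
    intro c
    have e : partialDeriv j.succ (fun y => c • f (p + r • y)) =
        fun y => (c * r) • partialDeriv j.succ f (p + r • y) := by
      funext y
      have hf1 : ContDiff ℝ 1 f := hf.of_le (by simp)
      have h1 : DifferentiableAt ℝ (fun y => f (p + r • y)) y :=
        (hf1.comp (by fun_prop : ContDiff ℝ 1 fun y : E n => p + r • y)).differentiable
          one_ne_zero y
      have h2 : fderiv ℝ (fun y => c • f (p + r • y)) y = _ := (h1.hasFDerivAt.const_smul c).fderiv
      rw [partialDeriv, h2, smul_apply, mul_smul, ← partialDeriv_comp_affine hf1]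
      rfl
    rw [wordDeriv_cons, wordDeriv_cons, e, ih (contDiff_partialDeriv hf _), List.length_cons,
      pow_succ']
    congr 1; ring

/-- **Cauchy estimates** for entire monogenic functions. -/
theorem exists_cauchy_estimate {n : ℕ} (hn : 1 ≤ n) {δ : ℝ} (hδ : 0 < δ) (hδ1 : δ ≤ 1) :
    ∃ C : ℝ, 0 ≤ C ∧ ∀ f : E n → Cl n, IsMonogenic f → ∀ (p : E n) (r M : ℝ), 0 < r →
      (∀ y : E n, ‖y - p‖ ≤ (1 + δ) * r → ‖f y‖ ≤ M) → ∀ l : List (Fin n),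
        ‖wordDeriv l f p‖ ≤ C * n.ascFactorial l.length * M * (r ^ l.length)⁻¹ := by
  obtain ⟨C, hC, h⟩ := exists_cauchy_estimate_ball hn hδ hδ1
  refine ⟨C, hC, fun f hf p r M hr hM l => ?_⟩
  have h1 := (h _ (hf.comp_affine p r)).2 M (fun y hy => hM _ (by
    rw [add_sub_cancel_left, norm_smul, Real.norm_of_nonneg hr.le, mul_comm]
    gcongr)) l
  rw [wordDeriv_comp_affine (hf.contDiff hn), smul_zero, add_zero, norm_smul,
    Real.norm_of_nonneg (by positivity)] at h1
  rw [← div_eq_mul_inv, le_div_iff₀ (by positivity), mul_comm]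
  exact h1

/-! ### Sums over words -/

/-- The last letter is split off because it is the derivative taken last and the rightmost factor of
the product. -/
theorem sum_word_succ {n k : ℕ} {M : Type*} [AddCommMonoid M] (F : List (Fin n) → M) :
    ∑ w : Fin (k + 1) → Fin n, F (List.ofFn w) =
      ∑ w : Fin k → Fin n, ∑ j, F (List.ofFn w ++ [j]) := by
  rw [← (Fin.snocEquiv (n := k) fun _ => Fin n).sum_comp, Fintype.sum_prod_type, Finset.sum_comm]
  refine Finset.sum_congr rfl fun w _ => Finset.sum_congr rfl fun j _ => ?_
  rw [List.ofFn_succ', List.concat_eq_append]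
  simp [Fin.snocEquiv]

theorem count_ofFn {α : Type*} [DecidableEq α] {k : ℕ} (w : Fin k → α) (a : α) :
    (List.ofFn w).count a = (Finset.univ.filter fun i => w i = a).card := by
  induction k with
  | zero => simp
  | succ k ih =>
    rw [List.ofFn_succ, List.count_cons, ih, Fin.card_filter_univ_succ]
    split_ifs with h1 h2 h2
    · ring
    · simp_all
    · simp_all
    · rfl

/-- The sum over the words of a multi-index, for all multi-indices of degree at most `q`, is the
sum over all words of length at most `q`. -/
theorem sum_multiIndexLE_fueterWords {n : ℕ} {M : Type*} [AddCommMonoid M]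
    (F : List (Fin n) → M) (q : ℕ) :
    ∑ m ∈ multiIndexLE n q, ∑ w ∈ fueterWords m, F (List.ofFn w) =
      ∑ k ∈ Finset.range (q + 1), ∑ w : Fin k → Fin n, F (List.ofFn w) := by
  have hcount : ∀ (k : ℕ) (w : Fin k → Fin n),
      ∑ j, (Finset.univ.filter fun i => w i = j).card = k := by
    intro k w
    have := Finset.card_eq_sum_card_fiberwise (s := Finset.univ) (t := Finset.univ) (f := w)
      (by simp)
    rw [← this]; simp
  have h1 : ∀ k ∈ Finset.range (q + 1), ∑ w : Fin k → Fin n, F (List.ofFn w) =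
      ∑ m ∈ multiIndexLE n q, ∑ w : Fin k → Fin n with
        (fun j => (Finset.univ.filter fun i => w i = j).card) = m, F (List.ofFn w) := by
    intro k hk
    rw [Finset.sum_fiberwise_of_maps_to]
    intro w _
    rw [mem_multiIndexLE, hcount]
    simpa [Nat.lt_succ_iff] using hk
  rw [Finset.sum_congr rfl h1, Finset.sum_comm]
  refine Finset.sum_congr rfl fun m hm => ?_
  rw [mem_multiIndexLE] at hm
  rw [Finset.sum_eq_single (∑ j, m j)]
  · refine Finset.sum_congr ?_ fun _ _ => rfl
    ext w
    simp [fueterWords, funext_iff]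
  · intro k _ hk
    refine Finset.sum_eq_zero fun w hw => absurd ?_ hk
    rw [Finset.mem_filter] at hw
    rw [← hw.2, hcount]
  · intro h
    simp at h
    omega

/-! ### The Taylor series -/

/-- The product `z_{j_1} ⋯ z_{j_k}` along a word. -/
noncomputable def wordProd {n : ℕ} (l : List (Fin n)) (x : E n) : Cl n :=
  (l.map fun j => fueterVar j x).prod

theorem norm_wordProd_mul_le {n : ℕ} (l : List (Fin n)) (x : E n) (a : Cl n) :
    ‖wordProd l x * a‖ ≤ ‖x‖ ^ l.length * ‖a‖ := by
  induction l with
  | nil => simp [wordProd]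
  | cons j l ih =>
    have e : wordProd (j :: l) x = fueterVar j x * wordProd l x := by simp [wordProd]
    rw [e, mul_assoc, List.length_cons, pow_succ', mul_assoc]
    exact (norm_fueterVar_mul_le n j x _).trans (mul_le_mul_of_nonneg_left ih (norm_nonneg _))

theorem IsMonogenic.partialDeriv {n : ℕ} {f : E n → Cl n} (hf : IsMonogenic f)
    (hs : ContDiff ℝ (⊤ : ℕ∞) f) (i : Fin (n + 1)) : IsMonogenic (partialDeriv i f) := by
  refine ⟨(contDiff_partialDeriv hs i).of_le (by simp), fun x => ?_⟩
  have h1 : dirac f = fun x => ∑ j, unit n j * Monogenic.partialDeriv j f x :=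
    funext (dirac_eq_sum f)
  have h2 : HasFDerivAt (dirac f) (∑ j, (clMul n (unit n j)).comp
      (fderiv ℝ (Monogenic.partialDeriv j f) x)) x := by
    rw [h1]
    exact HasFDerivAt.fun_sum fun j _ => hasFDerivAt_const_mul (unit n j)
      ((contDiff_partialDeriv hs j).differentiable (by simp) x).hasFDerivAt
  have h3 : dirac f = fun _ => 0 := funext hf.2
  rw [h3] at h2
  have h4 := h2.unique (hasFDerivAt_const (0 : Cl n) x)
  have h5 := congrArg (fun L => L (EuclideanSpace.single i (1 : ℝ))) h4
  rw [dirac_eq_sum]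
  simp only [partialDeriv_comm hs _ i]
  simpa [sum_apply, Monogenic.partialDeriv.eq_1 i] using h5

theorem IsMonogenic.wordDeriv {n : ℕ} {f : E n → Cl n} (hf : IsMonogenic f)
    (hs : ContDiff ℝ (⊤ : ℕ∞) f) (l : List (Fin n)) : IsMonogenic (wordDeriv l f) := by
  induction l generalizing f with
  | nil => exact hf
  | cons j l ih => exact ih (hf.partialDeriv hs _) (contDiff_partialDeriv hs _)

/-- The directional derivative of a monogenic function is `∑ z_j ∂_j f`. -/
theorem IsMonogenic.fderiv_apply {n : ℕ} {f : E n → Cl n} (hf : IsMonogenic f) (p x : E n) :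
    fderiv ℝ f p x = ∑ j, fueterVar j x * Monogenic.partialDeriv j.succ f p := by
  have h1 : x = ∑ i, x i • EuclideanSpace.single i (1 : ℝ) := by
    ext j
    simp [Finset.sum_apply, Pi.single_apply]
  have h2 := hf.2 p
  rw [dirac] at h2
  have h3 := eq_neg_of_add_eq_zero_left h2
  conv_lhs => rw [h1]
  rw [map_sum, Fin.sum_univ_succ, map_smul]
  change x 0 • Monogenic.partialDeriv 0 f p + _ = _
  rw [h3, smul_neg, Finset.smul_sum, ← Finset.sum_neg_distrib, ← Finset.sum_add_distrib]
  refine Finset.sum_congr rfl fun j _ => ?_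
  rw [map_smul, fueterVar, sub_mul, ← Algebra.smul_def, smul_mul_assoc]
  change _ + x j.succ • Monogenic.partialDeriv j.succ f p = _
  abel

theorem wordDeriv_append {n : ℕ} (l l' : List (Fin n)) (f : E n → Cl n) :
    wordDeriv (l ++ l') f = wordDeriv l' (wordDeriv l f) := List.foldl_append ..

/-- The `k`-th derivative at `p` of a monogenic function in the direction `x`. -/
noncomputable def wordSum {n : ℕ} (f : E n → Cl n) (k : ℕ) (x p : E n) : Cl n :=
  ∑ w : Fin k → Fin n, wordProd (List.ofFn w) x * wordDeriv (List.ofFn w) f p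

/-- Each $\partial_wf$ is again monogenic, so its directional derivative is
$\sum_jz_j\,\partial_j\partial_wf$. The products of $z$'s depend only on the direction $x$, hence
are constant along the line. -/
theorem IsMonogenic.hasDerivAt_wordSum {n : ℕ} {f : E n → Cl n} (hf : IsMonogenic f)
    (hs : ContDiff ℝ (⊤ : ℕ∞) f) (k : ℕ) (x : E n) (t : ℝ) :
    HasDerivAt (fun t : ℝ => wordSum f k x (t • x)) (wordSum f (k + 1) x (t • x)) t := by
  have e : wordSum f (k + 1) x (t • x) = ∑ w : Fin k → Fin n,
      wordProd (List.ofFn w) x * fderiv ℝ (Monogenic.wordDeriv (List.ofFn w) f) (t • x) x := by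
    rw [wordSum, sum_word_succ fun l => wordProd l x * Monogenic.wordDeriv l f (t • x)]
    refine Finset.sum_congr rfl fun w _ => ?_
    rw [(hf.wordDeriv hs _).fderiv_apply, Finset.mul_sum]
    refine Finset.sum_congr rfl fun j _ => ?_
    rw [wordDeriv_append, ← mul_assoc]
    simp [wordProd]
  rw [e]
  refine HasDerivAt.fun_sum fun w _ => ?_
  have h1 := ((contDiff_wordDeriv hs (List.ofFn w)).differentiable (by simp) (t • x)).hasFDerivAt
  have h2 := h1.comp_hasDerivAt t ((hasDerivAt_id t).smul_const x)
  rw [one_smul] at h2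
  exact (clMul n (wordProd (List.ofFn w) x)).hasFDerivAt.comp_hasDerivAt t h2

theorem IsMonogenic.iteratedDerivWithin_line {n : ℕ} {f : E n → Cl n} (hf : IsMonogenic f)
    (hs : ContDiff ℝ (⊤ : ℕ∞) f) (k : ℕ) (x : E n) {t : ℝ} (ht : t ∈ Set.Icc (0 : ℝ) 1) :
    iteratedDerivWithin k (fun t : ℝ => f (t • x)) (Set.Icc 0 1) t = wordSum f k x (t • x) := by
  induction k generalizing t with
  | zero => simp [wordSum, wordProd]
  | succ k ih =>
    rw [iteratedDerivWithin_succ, derivWithin_congr (fun y hy => ih hy) (ih ht)]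
    exact (hf.hasDerivAt_wordSum hs k x t).hasDerivWithinAt.derivWithin
      (uniqueDiffOn_Icc zero_lt_one t ht)

theorem norm_wordSum_le {n : ℕ} {f : E n → Cl n} {k : ℕ} {x p : E n} {B : ℝ}
    (hB : ∀ l : List (Fin n), l.length = k → ‖wordDeriv l f p‖ ≤ B) :
    ‖wordSum f k x p‖ ≤ n ^ k * (‖x‖ ^ k * B) := by
  refine (norm_sum_le_of_le (f := fun w : Fin k → Fin n =>
    wordProd (List.ofFn w) x * wordDeriv (List.ofFn w) f p) (n := fun _ => ‖x‖ ^ k * B)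
    Finset.univ fun w _ => ?_).trans (le_of_eq ?_)
  · refine (norm_wordProd_mul_le _ x _).trans ?_
    rw [List.length_ofFn]
    exact mul_le_mul_of_nonneg_left (hB _ (by simp)) (by positivity)
  · simp

/-- Here $n(n+1)\cdots(n+k-1)/k!=\binom{n-1+k}{n-1}$, so this is a binomial series. -/
theorem summable_ascFactorial_geometric (n : ℕ) (hn : 1 ≤ n) {t : ℝ} (h0 : 0 ≤ t) (h1 : t < 1) :
    Summable fun k : ℕ => (n.ascFactorial k : ℝ) * ((k.factorial : ℝ))⁻¹ * t ^ k := by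
  obtain ⟨s, rfl⟩ : ∃ s, n = s + 1 := ⟨n - 1, by omega⟩
  have h := summable_choose_mul_geometric_of_norm_lt_one (R := ℝ) s
    (by rwa [Real.norm_of_nonneg h0])
  refine h.congr fun k => ?_
  congr 1
  rw [Nat.ascFactorial_eq_factorial_mul_choose, add_comm s k, Nat.choose_symm_add]
  push_cast
  field_simp

/-- The Taylor formula of a monogenic function along words. -/
theorem IsMonogenic.tendsto_sum_wordSum {n : ℕ} (hn : 1 ≤ n) {f : E n → Cl n}
    (hf : IsMonogenic f) (x : E n) :
    Tendsto (fun q : ℕ => ∑ k ∈ Finset.range (q + 1), ((k.factorial : ℝ)⁻¹) • wordSum f k x 0)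
      atTop (𝓝 (f x)) := by
  have hs := hf.contDiff hn
  obtain ⟨C, hC, hCau⟩ := exists_cauchy_estimate hn one_pos le_rfl
  have hn0 : (0 : ℝ) < n := by exact_mod_cast hn
  -- This gives $n\|x\|/r\le1/4$. One factor $2^{-(q+1)}$ is spent on the surplus $q+1$, since the
  -- Taylor remainder is divided by $q!$ and not by $(q+1)!$; the other ensures convergence.
  let r : ℝ := 4 * n * (‖x‖ + 1)
  have hr : 0 < r := by positivity
  obtain ⟨M, hM⟩ := (isCompact_closedBall (0 : E n) (‖x‖ + 2 * r)).exists_bound_of_continuousOn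
    hf.1.continuous.continuousOn
  have hM0 : 0 ≤ M := (norm_nonneg _).trans (hM 0 (by simp; positivity))
  have hrem : ∀ q : ℕ, ‖f x - ∑ k ∈ Finset.range (q + 1),
      ((k.factorial : ℝ)⁻¹) • wordSum f k x 0‖ ≤
      C * M * ((n.ascFactorial (q + 1) : ℝ) * ((q + 1).factorial : ℝ)⁻¹ * (1 / 2) ^ (q + 1)) := by
    intro q
    have hcd : ContDiff ℝ (⊤ : ℕ∞) fun t : ℝ => f (t • x) :=
      hs.comp (contDiff_id.smul contDiff_const)
    have hb : ∀ t ∈ Set.Icc (0 : ℝ) 1,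
        ‖iteratedDerivWithin (q + 1) (fun t : ℝ => f (t • x)) (Set.Icc 0 1) t‖ ≤
        n ^ (q + 1) * (‖x‖ ^ (q + 1) *
          (C * n.ascFactorial (q + 1) * M * (r ^ (q + 1))⁻¹)) := by
      intro t ht
      rw [hf.iteratedDerivWithin_line hs _ x ht]
      refine norm_wordSum_le fun l hl => ?_
      rw [← hl]
      refine hCau f hf (t • x) r M hr (fun y hy => hM y ?_) l
      rw [mem_closedBall_zero_iff]
      have h1 : ‖t • x‖ ≤ ‖x‖ := by
        rw [norm_smul, Real.norm_of_nonneg ht.1]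
        exact mul_le_of_le_one_left (norm_nonneg _) ht.2
      have h2 := norm_le_norm_add_norm_sub' y (t • x)
      linarith
    have h1 := taylor_mean_remainder_bound zero_le_one
      ((hcd.of_le (by exact_mod_cast le_top)).contDiffOn (s := Set.Icc 0 1)) (n := q)
      (Set.right_mem_Icc.mpr zero_le_one) hb
    rw [taylor_within_apply] at h1
    have h2 : ∀ k ∈ Finset.range (q + 1), (((k.factorial : ℝ)⁻¹ * (1 - 0) ^ k) •
        iteratedDerivWithin k (fun t : ℝ => f (t • x)) (Set.Icc 0 1) 0) =
        ((k.factorial : ℝ)⁻¹) • wordSum f k x 0 := by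
      intro k _
      rw [hf.iteratedDerivWithin_line hs k x (Set.left_mem_Icc.mpr zero_le_one)]
      simp
    rw [Finset.sum_congr rfl h2, one_smul] at h1
    refine h1.trans ?_
    have h3 : (n : ℝ) ^ (q + 1) * ‖x‖ ^ (q + 1) * (r ^ (q + 1))⁻¹ ≤ (1 / 4) ^ (q + 1) := by
      rw [← mul_pow, ← inv_pow, ← mul_pow]
      refine pow_le_pow_left₀ (by positivity) ?_ _
      rw [← div_eq_mul_inv, div_le_iff₀ hr]
      simp only [r]
      nlinarith [norm_nonneg x]
    have h4 : ((q : ℝ) + 1) * (1 / 4) ^ (q + 1) ≤ (1 / 2) ^ (q + 1) := by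
      have h5 : ((q : ℝ) + 1) ≤ 2 ^ (q + 1) := by
        exact_mod_cast (Nat.lt_two_pow_self (n := q + 1)).le
      calc ((q : ℝ) + 1) * (1 / 4) ^ (q + 1) ≤ 2 ^ (q + 1) * (1 / 4) ^ (q + 1) := by gcongr
        _ = (1 / 2) ^ (q + 1) := by rw [← mul_pow]; norm_num
    have h6 : (q.factorial : ℝ)⁻¹ = (q + 1) * ((q + 1).factorial : ℝ)⁻¹ := by
      rw [Nat.factorial_succ]; push_cast; field_simp
    rw [div_eq_mul_inv, h6]
    calc _ = C * M * n.ascFactorial (q + 1) * ((q + 1).factorial : ℝ)⁻¹ * ((q + 1) *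
          (n ^ (q + 1) * ‖x‖ ^ (q + 1) * (r ^ (q + 1))⁻¹)) := by ring
      _ ≤ C * M * n.ascFactorial (q + 1) * ((q + 1).factorial : ℝ)⁻¹ * ((q + 1) *
          (1 / 4) ^ (q + 1)) := by gcongr
      _ ≤ C * M * n.ascFactorial (q + 1) * ((q + 1).factorial : ℝ)⁻¹ * (1 / 2) ^ (q + 1) := by
          gcongr
      _ = _ := by ring
  have hlim := (((summable_ascFactorial_geometric n hn (t := 1 / 2) (by norm_num)
    (by norm_num)).tendsto_atTop_zero.comp (tendsto_add_atTop_nat 1)).const_mul (C * M))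
  rw [mul_zero] at hlim
  rw [tendsto_iff_norm_sub_tendsto_zero]
  refine squeeze_zero (fun _ => norm_nonneg _) (fun q => ?_) hlim
  rw [norm_sub_rev]
  exact hrem q

/-- Only the letter counts of the word are needed, since the partial derivatives of a smooth
function commute. -/
theorem multiDeriv_eq_wordDeriv {n : ℕ} (m : Fin n → ℕ) (f : E n → Cl n) :
    ∃ L : List (Fin n), multiDeriv m f = wordDeriv L f ∧ ∀ i, L.count i = m i := by
  suffices h : ∀ J : List (Fin n), J.Nodup → ∃ L : List (Fin n),
      J.foldr (fun j g => (partialDeriv j.succ)^[m j] g) f = wordDeriv L f ∧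
        ∀ i, L.count i = if i ∈ J then m i else 0 by
    obtain ⟨L, h1, h2⟩ := h (List.finRange n) (List.nodup_finRange n)
    exact ⟨L, h1, by simpa using h2⟩
  intro J
  induction J with
  | nil => exact fun _ => ⟨[], by simp⟩
  | cons j J ih =>
    intro hJ
    rw [List.nodup_cons] at hJ
    obtain ⟨L, h1, h2⟩ := ih hJ.2
    refine ⟨L ++ List.replicate (m j) j, ?_, fun i => ?_⟩
    · rw [List.foldr_cons, h1, wordDeriv_append]
      generalize wordDeriv L f = g
      generalize m j = k
      induction k generalizing g with
      | zero => rfl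
      | succ k ihk => rw [Function.iterate_succ_apply, ihk, List.replicate_succ, wordDeriv_cons]
    · rw [List.count_append, h2, List.count_replicate]
      by_cases hij : i = j
      · subst hij; simp [hJ.1]
      · simp [hij, Ne.symm hij]

/-- All words of $\mathbf m$ yield the same derivative, and the two factors $\mathbf m!$ cancel,
leaving $1/|\mathbf m|!$. -/
theorem fueter_mul_taylorCoeff {n : ℕ} {f : E n → Cl n} (hs : ContDiff ℝ (⊤ : ℕ∞) f)
    (m : Fin n → ℕ) (x : E n) : fueter m x * taylorCoeff f m =
      ∑ w ∈ fueterWords m, (((List.ofFn w).length.factorial : ℝ)⁻¹) •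
        (wordProd (List.ofFn w) x * wordDeriv (List.ofFn w) f 0) := by
  have h1 : ∀ w ∈ fueterWords m, wordDeriv (List.ofFn w) f 0 = multiDeriv m f 0 := by
    intro w hw
    obtain ⟨L, h1, h2⟩ := multiDeriv_eq_wordDeriv m f
    rw [h1]
    refine congrFun (wordDeriv_perm (List.perm_iff_count.mpr fun j => ?_) hs) 0
    rw [h2, count_ofFn]
    exact (Finset.mem_filter.mp hw).2 j
  have h2 : (∏ j, ((m j).factorial : ℝ)) ≠ 0 :=
    Finset.prod_ne_zero_iff.mpr fun j _ => by positivity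
  have h3 : ((∑ j, m j).factorial : ℝ) ≠ 0 := by positivity
  rw [fueter, taylorCoeff, smul_mul_smul_comm, Finset.sum_mul, Finset.smul_sum]
  refine Finset.sum_congr rfl fun w hw => ?_
  rw [h1 w hw, List.length_ofFn, wordProd, List.map_ofFn]
  congr 1
  push_cast
  field_simp

theorem tendsto_taylorSum_multiIndexLE {n : ℕ} (hn : 1 ≤ n) {f : E n → Cl n}
    (hf : IsMonogenic f) (x : E n) :
    Tendsto (fun q => taylorSum f (multiIndexLE n q) x) atTop (𝓝 (f x)) := by
  refine (hf.tendsto_sum_wordSum hn x).congr fun q => ?_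
  simp only [taylorSum, fueter_mul_taylorCoeff (hf.contDiff hn)]
  rw [sum_multiIndexLE_fueterWords fun l =>
    ((l.length.factorial : ℝ)⁻¹) • (wordProd l x * wordDeriv l f 0)]
  refine Finset.sum_congr rfl fun k _ => ?_
  rw [wordSum, Finset.smul_sum]
  simp only [List.length_ofFn]

/-! ### The Fueter polynomials are monogenic -/

/-- The linear function `∑ t_j z_j`. -/
noncomputable def fueterLin {n : ℕ} (t : Fin n → ℝ) : E n →L[ℝ] Cl n :=
  ∑ j, t j • ((EuclideanSpace.proj (𝕜 := ℝ) j.succ).smulRight (1 : Cl n) -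
    (EuclideanSpace.proj (𝕜 := ℝ) 0).smulRight (imUnit n j))

theorem fueterLin_apply {n : ℕ} (t : Fin n → ℝ) (x : E n) :
    fueterLin t x = ∑ j, t j • fueterVar j x := by
  simp [fueterLin, fueterVar, Algebra.algebraMap_eq_smul_one]

theorem fueterLin_eq {n : ℕ} (t : Fin n → ℝ) (x : E n) :
    fueterLin t x = algebraMap ℝ (Cl n) (∑ j, t j * x j.succ) - x 0 • ∑ j, t j • imUnit n j := by
  rw [fueterLin_apply, map_sum, Finset.smul_sum, ← Finset.sum_sub_distrib]
  refine Finset.sum_congr rfl fun j _ => ?_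
  rw [fueterVar, smul_sub, map_mul, Algebra.smul_def, smul_comm]

theorem fueterLin_commute {n : ℕ} (t : Fin n → ℝ) (x y : E n) :
    Commute (fueterLin t x) (fueterLin t y) := by
  rw [fueterLin_eq, fueterLin_eq]
  have h1 : ∀ (r : ℝ) (a : Cl n), Commute (algebraMap ℝ (Cl n) r) a := Algebra.commutes
  refine Commute.sub_left (h1 _ _) (Commute.sub_right (h1 _ _).symm ?_)
  exact ((Commute.refl _).smul_left _).smul_right _

/-- The values of $\sum_jt_jz_j$ commute with each other, being combinations of $1$ and
$\sum_jt_je_j$; hence the scalar power rule holds. For $k=0$ the truncated exponent is harmless, as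
the factor $k$ vanishes. -/
theorem partialDeriv_fueterLin_pow {n : ℕ} (t : Fin n → ℝ) (b : Cl n) (k : ℕ) (x : E n)
    (i : Fin (n + 1)) : partialDeriv i (fun x => fueterLin t x ^ k * b) x =
      (k : ℝ) • (fueterLin t (EuclideanSpace.single i 1) * (fueterLin t x ^ (k - 1) * b)) := by
  suffices h : ∃ L : E n →L[ℝ] Cl n, HasFDerivAt (fun x => fueterLin t x ^ k * b) L x ∧
      ∀ v, L v = (k : ℝ) • (fueterLin t v * (fueterLin t x ^ (k - 1) * b)) by
    obtain ⟨L, h1, h2⟩ := h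
    rw [partialDeriv, h1.fderiv, h2]
  induction k with
  | zero => exact ⟨0, by simpa using hasFDerivAt_const b x, by simp⟩
  | succ k ih =>
    obtain ⟨L, h1, h2⟩ := ih
    have h3 := (clMul n).hasFDerivAt_of_bilinear ((fueterLin t).hasFDerivAt (x := x)) h1
    refine ⟨_, h3.congr_of_eventuallyEq (Eventually.of_forall fun y => ?_), fun v => ?_⟩
    · simp [pow_succ', mul_assoc]
    · change fueterLin t x * L v + fueterLin t v * (fueterLin t x ^ k * b) = _
      rw [h2]
      cases k with
      | zero => simp
      | succ k =>
        simp only [Nat.add_sub_cancel]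
        have h4 : fueterLin t x * (fueterLin t v * (fueterLin t x ^ k * b)) =
            fueterLin t v * (fueterLin t x ^ (k + 1) * b) := by
          rw [← mul_assoc, (fueterLin_commute t x v).eq, mul_assoc, pow_succ']
          simp only [mul_assoc]
        rw [mul_smul_comm, h4]
        push_cast
        rw [add_smul ((k : ℝ) + 1), one_smul]

theorem dirac_fueterLin_pow {n : ℕ} (t : Fin n → ℝ) (b : Cl n) (k : ℕ) (x : E n) :
    dirac (fun x => fueterLin t x ^ k * b) x = 0 := by
  have h : ∑ i, unit n i * fueterLin t (EuclideanSpace.single i 1) = 0 := by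
    rw [Fin.sum_univ_succ]
    simp [fueterLin_eq, Fin.succ_ne_zero, ← Algebra.commutes, ← Algebra.smul_def]
  simp only [dirac_eq_sum, partialDeriv_fueterLin_pow, mul_smul_comm, ← Finset.smul_sum,
    ← mul_assoc, ← Finset.sum_mul]
  rw [h]
  simp

/-- Expanding the power without commuting factors gives one term per word: $(\sum_jt_jz_j)^k$
generates the Fueter polynomials of degree $k$. -/
theorem sum_word_fueterLin {n : ℕ} (t : Fin n → ℝ) (k : ℕ) (x : E n) :
    ∑ w : Fin k → Fin n, ((List.ofFn w).map t).prod • wordProd (List.ofFn w) x =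
      fueterLin t x ^ k := by
  induction k with
  | zero => simp [wordProd]
  | succ k ih =>
    rw [sum_word_succ fun l => (l.map t).prod • wordProd l x, pow_succ, ← ih, Finset.sum_mul]
    refine Finset.sum_congr rfl fun w _ => ?_
    rw [fueterLin_apply, Finset.mul_sum]
    refine Finset.sum_congr rfl fun j _ => ?_
    rw [smul_mul_smul_comm]
    simp [wordProd]

/-- The sum of `z_{j_1} ⋯ z_{j_k}` over the words of a multi-index. -/
noncomputable def fueterSum {n : ℕ} (m : Fin n → ℕ) (x : E n) : Cl n :=
  ∑ w ∈ fueterWords m, wordProd (List.ofFn w) x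

theorem fueter_eq_smul_fueterSum {n : ℕ} (m : Fin n → ℕ) (x : E n) :
    fueter m x = (((∏ j, (m j).factorial : ℕ) : ℝ) / ((∑ j, m j).factorial : ℝ)) •
      fueterSum m x := by
  simp only [fueter, fueterSum, wordProd, List.map_ofFn]
  rfl

theorem sum_pow_smul_fueterSum {n : ℕ} (t : Fin n → ℝ) (q : ℕ) (x : E n) :
    ∑ m ∈ multiIndexLE n q, (∏ j, t j ^ m j) • fueterSum m x =
      ∑ k ∈ Finset.range (q + 1), fueterLin t x ^ k := by
  simp only [← sum_word_fueterLin]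
  rw [← sum_multiIndexLE_fueterWords fun l => (l.map t).prod • wordProd l x]
  refine Finset.sum_congr rfl fun m _ => ?_
  rw [fueterSum, Finset.smul_sum]
  refine Finset.sum_congr rfl fun w hw => ?_
  congr 1
  rw [List.map_ofFn, List.prod_ofFn]
  have h := Finset.prod_fiberwise' (s := Finset.univ) w t
  simp only [Finset.prod_const] at h
  rw [Function.comp_def, ← h]
  exact Finset.prod_congr rfl fun j _ => by rw [(Finset.mem_filter.mp hw).2 j]

theorem contDiff_wordProd {n : ℕ} (l : List (Fin n)) :
    ContDiff ℝ (⊤ : ℕ∞) (wordProd l : E n → Cl n) := by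
  induction l with
  | nil => exact contDiff_const
  | cons j l ih =>
    have h1 : ContDiff ℝ (⊤ : ℕ∞) (fueterVar j : E n → Cl n) := by
      have : (fueterVar j : E n → Cl n) = fueterLin (Pi.single j 1) := by
        funext x
        simp [fueterLin_apply, Pi.single_apply]
      rw [this]
      exact ContinuousLinearMap.contDiff _
    have h2 : (wordProd (j :: l) : E n → Cl n) = fun x => clMul n (fueterVar j x) (wordProd l x) := by
      funext x; simp [wordProd]
    rw [h2]
    exact ((clMul n).contDiff.comp h1).clm_apply ih

theorem contDiff_fueterSum_mul {n : ℕ} (m : Fin n → ℕ) (b : Cl n) :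
    ContDiff ℝ (⊤ : ℕ∞) fun x : E n => fueterSum m x * b :=
  ((clMul n).flip b).contDiff.comp (ContDiff.sum fun _ _ => contDiff_wordProd _)

theorem dirac_sum_smul {n : ℕ} {ι : Type*} (s : Finset ι) (r : ι → ℝ) (g : ι → E n → Cl n)
    (hg : ∀ i ∈ s, Differentiable ℝ (g i)) (x : E n) :
    dirac (fun x => ∑ i ∈ s, r i • g i x) x = ∑ i ∈ s, r i • dirac (g i) x := by
  have h : ∀ j, partialDeriv j (fun x => ∑ i ∈ s, r i • g i x) x =
      ∑ i ∈ s, r i • partialDeriv j (g i) x := by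
    intro j
    have h1 := HasFDerivAt.fun_sum fun i hi => ((hg i hi x).hasFDerivAt.const_smul (r i))
    have h2 : fderiv ℝ (fun x => ∑ i ∈ s, r i • g i x) x = _ := h1.fderiv
    rw [partialDeriv, h2, sum_apply]
    rfl
  simp only [dirac_eq_sum, h, Finset.mul_sum, Finset.smul_sum, mul_smul_comm]
  rw [Finset.sum_comm]

/-- In each coordinate this is a real polynomial in $t$ that vanishes everywhere, so its
coefficients are zero. -/
theorem eq_zero_of_forall_sum_pow_smul {n : ℕ} (s : Finset (Fin n → ℕ)) (c : (Fin n → ℕ) → Cl n)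
    (h : ∀ t : Fin n → ℝ, ∑ m ∈ s, (∏ j, t j ^ m j) • c m = 0) : ∀ m ∈ s, c m = 0 := by
  intro m hm
  refine (clBasis n).ext_elem fun S => ?_
  let e := (Finsupp.equivFunOnFinite (α := Fin n) (M := ℕ)).symm
  let Q : MvPolynomial (Fin n) ℝ :=
    ∑ m ∈ s, MvPolynomial.monomial (e m) ((clBasis n).repr (c m) S)
  have hQ : Q = 0 := by
    refine MvPolynomial.funext fun t => ?_
    have h1 := congrArg (fun a => (clBasis n).repr a S) (h t)
    simp only [map_sum, map_smul, Finsupp.coe_finsetSum, Finset.sum_apply, Finsupp.smul_apply,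
      smul_eq_mul, map_zero, Finsupp.coe_zero, Pi.zero_apply] at h1
    simp only [Q, map_sum, MvPolynomial.eval_monomial, map_zero]
    rw [← h1]
    refine Finset.sum_congr rfl fun m _ => ?_
    rw [mul_comm, Finsupp.prod_fintype _ _ (by simp)]
    rfl
  have h2 := congrArg (MvPolynomial.coeff (e m)) hQ
  simp only [Q, MvPolynomial.coeff_sum, MvPolynomial.coeff_monomial, e.injective.eq_iff,
    Finset.sum_ite_eq', hm, if_true, MvPolynomial.coeff_zero] at h2
  simpa using h2

/-- The powers of $\sum_jt_jz_j$ are monogenic for every $t$, and the Fueter polynomials are their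
coefficients in $t$. Comparing coefficients of $t^{\mathbf m}$ after applying $\mathcal D$ gives the
claim. -/
theorem isMonogenic_fueter_mul {n : ℕ} (m : Fin n → ℕ) (b : Cl n) :
    IsMonogenic fun x : E n => fueter m x * b := by
  have h : IsMonogenic fun x : E n => fueterSum m x * b := by
    refine ⟨(contDiff_fueterSum_mul m b).of_le (by simp), fun x => ?_⟩
    refine eq_zero_of_forall_sum_pow_smul (multiIndexLE n (∑ j, m j))
      (fun m => dirac (fun x => fueterSum m x * b) x) (fun t => ?_) m (mem_multiIndexLE.mpr le_rfl)
    rw [← dirac_sum_smul _ _ _ fun m _ => (contDiff_fueterSum_mul m b).differentiable (by simp)]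
    have e : (fun x : E n => ∑ m' ∈ multiIndexLE n (∑ j, m j),
        (∏ j, t j ^ m' j) • (fueterSum m' x * b)) =
        fun x => ∑ k ∈ Finset.range (∑ j, m j + 1), (1 : ℝ) • (fueterLin t x ^ k * b) := by
      funext x
      simp only [one_smul, ← smul_mul_assoc, ← Finset.sum_mul, sum_pow_smul_fueterSum]
    rw [e, dirac_sum_smul]
    · simp [dirac_fueterLin_pow]
    · intro k _
      have h1 : ContDiff ℝ (⊤ : ℕ∞) fun x : E n => fueterLin t x ^ k * b := by
        simp only [← sum_word_fueterLin]
        exact ((clMul n).flip b).contDiff.comp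
          (ContDiff.sum fun w _ => (contDiff_wordProd _).const_smul _)
      exact h1.differentiable (by simp)
  have e : (fun x : E n => fueter m x * b) =
      (((∏ j, (m j).factorial : ℕ) : ℝ) / ((∑ j, m j).factorial : ℝ)) •
        fun x : E n => fueterSum m x * b := by
    funext x
    rw [fueter_eq_smul_fueterSum, smul_mul_assoc]
    rfl
  rw [e]
  exact h.smul _

theorem norm_fueter_mul_le {n : ℕ} (m : Fin n → ℕ) :
    ∃ C : ℝ, 0 ≤ C ∧ ∀ (x : E n) (b : Cl n), ‖fueter m x * b‖ ≤ C * ‖x‖ ^ (∑ j, m j) * ‖b‖ := by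
  refine ⟨(((∏ j, (m j).factorial : ℕ) : ℝ) / ((∑ j, m j).factorial : ℝ)) *
    (fueterWords m).card, by positivity, fun x b => ?_⟩
  rw [fueter_eq_smul_fueterSum, smul_mul_assoc, norm_smul, Real.norm_of_nonneg (by positivity),
    fueterSum, Finset.sum_mul, mul_assoc, mul_assoc]
  refine mul_le_mul_of_nonneg_left ?_ (by positivity)
  refine (norm_sum_le_of_le (n := fun _ => ‖x‖ ^ (∑ j, m j) * ‖b‖) _ fun w _ => ?_).trans
    (le_of_eq (by simp))
  simpa using norm_wordProd_mul_le (List.ofFn w) x b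

/-! ### Proximate orders -/

theorem IsProximateOrder.eventually_rpow_le {ρ : ℝ → ℝ} {ord : ℝ} (hρ : IsProximateOrder ρ ord)
    (hord : 0 < ord) : ∀ᶠ r in atTop, r ^ (ord / 2) ≤ r ^ ρ r := by
  filter_upwards [hρ.tendsto.eventually_const_le (show ord / 2 < ord by linarith),
    eventually_ge_atTop 1] with r hr h1
  exact Real.rpow_le_rpow_of_exponent_le h1 hr

/-- Powers are dominated by `exp (ε r^{ρ(r)})`. -/
theorem IsProximateOrder.exists_pow_le {ρ : ℝ → ℝ} {ord : ℝ} (hρ : IsProximateOrder ρ ord)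
    (hord : 0 < ord) {ε : ℝ} (hε : 0 < ε) (k : ℕ) :
    ∃ C : ℝ, ∀ r, 0 ≤ r → r ^ k ≤ C * Real.exp (ε * r ^ ρ r) := by
  -- With $u=r^{ord/2}$ one has $r^k=u^{2k/ord}$, which $e^{\varepsilon u}$ dominates; finally $u\le
  -- r^{\rho(r)}$ for large $r$.
  have h1 := (tendsto_rpow_mul_exp_neg_mul_atTop_nhds_zero (2 * k / ord) ε hε).comp
    (tendsto_rpow_atTop (half_pos hord))
  have h2 := h1.eventually_le_const one_pos
  obtain ⟨R, hR⟩ := eventually_atTop.mp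
    ((h2.and (hρ.eventually_rpow_le hord)).and (eventually_ge_atTop 1))
  refine ⟨max 1 (|R| ^ k), fun r hr => ?_⟩
  rcases le_total R r with h | h
  · obtain ⟨⟨h3, h4⟩, h5⟩ := hR r h
    have h6 : (r ^ (ord / 2)) ^ (2 * k / ord) = r ^ k := by
      rw [← Real.rpow_mul hr, ← Real.rpow_natCast]
      congr 1
      field_simp
    simp only [Function.comp_apply] at h3
    rw [h6, neg_mul, Real.exp_neg, ← div_eq_mul_inv, div_le_one (Real.exp_pos _)] at h3
    calc r ^ k ≤ Real.exp (ε * r ^ (ord / 2)) := h3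
      _ ≤ 1 * Real.exp (ε * r ^ ρ r) := by rw [one_mul]; gcongr
      _ ≤ _ := by gcongr; exact le_max_left _ _
  · have h3 : r ^ k ≤ |R| ^ k := pow_le_pow_left₀ hr (h.trans (le_abs_self R)) k
    have h4 : 1 ≤ Real.exp (ε * r ^ ρ r) := Real.one_le_exp (by positivity)
    calc r ^ k ≤ max 1 (|R| ^ k) * 1 := by rw [mul_one]; exact h3.trans (le_max_right _ _)
      _ ≤ _ := by gcongr

/-- `r^{ρ(r)}` is, up to `ε`, of regular variation with index `ord`. -/
theorem IsProximateOrder.exists_rpow_le {ρ : ℝ → ℝ} {ord : ℝ} (hρ : IsProximateOrder ρ ord)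
    (hord : 0 < ord) {ε l : ℝ} (hε : 0 < ε) (hl : 1 ≤ l) :
    ∃ R₀ : ℝ, 1 ≤ R₀ ∧ ∀ R, R₀ ≤ R → ∀ s, 0 ≤ s → s ≤ l * R →
      s ^ ρ s ≤ l ^ (ord + ε) * R ^ ρ R := by
  have hsum : Tendsto (fun r => deriv ρ r * r * Real.log r + ρ r) atTop (𝓝 ord) := by
    simpa using hρ.tendsto_deriv.add hρ.tendsto
  obtain ⟨R₁, hR₁⟩ := eventually_atTop.mp (((hsum.eventually_const_le hord).and
    (hsum.eventually_le_const (show ord < ord + ε by linarith))).and (eventually_ge_atTop 1))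
  have hR₁1 : 1 ≤ R₁ := (hR₁ R₁ le_rfl).2
  -- $h$ is the logarithm of $r^{\rho(r)}$, and $r h'(r)=\rho'(r)\,r\log r+\rho(r)\to ord$. So
  -- eventually $h$ increases while $h-(ord+\varepsilon)\log$ decreases.
  let h : ℝ → ℝ := fun r => ρ r * Real.log r
  have hder : ∀ r, R₁ ≤ r → HasDerivAt h (deriv ρ r * Real.log r + ρ r * r⁻¹) r := by
    intro r hr
    have hr0 : 0 < r := by linarith
    exact ((hρ.differentiableOn r hr0.le).differentiableAt (Ici_mem_nhds hr0)).hasDerivAt.mul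
      (Real.hasDerivAt_log hr0.ne')
  have heq : ∀ r, R₁ ≤ r → deriv ρ r * Real.log r + ρ r * r⁻¹ =
      (deriv ρ r * r * Real.log r + ρ r) * r⁻¹ := by
    intro r hr
    have hr0 : r ≠ 0 := by linarith
    field_simp
  have hmono : MonotoneOn h (Set.Ici R₁) := by
    refine monotoneOn_of_deriv_nonneg (convex_Ici _)
      (fun r hr => (hder r hr).continuousAt.continuousWithinAt)
      (fun r hr => (hder r (interior_subset hr)).differentiableAt.differentiableWithinAt)
      fun r hr => ?_
    have hr' : R₁ ≤ r := interior_subset hr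
    rw [(hder r hr').deriv, heq r hr']
    exact mul_nonneg (hR₁ r hr').1.1 (inv_nonneg.mpr (by linarith))
  have hanti : AntitoneOn (fun r => h r - (ord + ε) * Real.log r) (Set.Ici R₁) := by
    have hd : ∀ r, R₁ ≤ r → HasDerivAt (fun r => h r - (ord + ε) * Real.log r)
        (deriv ρ r * Real.log r + ρ r * r⁻¹ - (ord + ε) * r⁻¹) r := fun r hr =>
      (hder r hr).sub ((Real.hasDerivAt_log (by linarith)).const_mul _)
    refine antitoneOn_of_deriv_nonpos (convex_Ici _)
      (fun r hr => (hd r hr).continuousAt.continuousWithinAt)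
      (fun r hr => (hd r (interior_subset hr)).differentiableAt.differentiableWithinAt)
      fun r hr => ?_
    have hr' : R₁ ≤ r := interior_subset hr
    rw [(hd r hr').deriv, heq r hr', ← sub_mul]
    exact mul_nonpos_of_nonpos_of_nonneg (by linarith [(hR₁ r hr').1.2])
      (inv_nonneg.mpr (by linarith))
  have hexp : ∀ r, 0 < r → r ^ ρ r = Real.exp (h r) := by
    intro r hr
    rw [Real.rpow_def_of_pos hr, mul_comm]
  -- Below $R_1$ there is no monotonicity, only boundedness of $\rho$; there $s^{\rho(s)}\le R_1^B$,
  -- which $R^{\rho(R)}$ exceeds once $R$ is large.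
  obtain ⟨B, hB⟩ := (isCompact_Icc (a := (0 : ℝ)) (b := R₁)).exists_bound_of_continuousOn
    (hρ.differentiableOn.continuousOn.mono fun r hr => hr.1)
  obtain ⟨R₂, hR₂⟩ := eventually_atTop.mp ((hρ.eventually_rpow_le hord).and
    ((tendsto_rpow_atTop (half_pos hord)).eventually_ge_atTop (R₁ ^ B)))
  refine ⟨max R₁ R₂, hR₁1.trans (le_max_left _ _), fun R hR s hs0 hs => ?_⟩
  have hR1 : R₁ ≤ R := (le_max_left _ _).trans hR
  have hR2 : R₂ ≤ R := (le_max_right _ _).trans hR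
  have hRpos : 0 < R := by linarith
  have hl1 : 1 ≤ l ^ (ord + ε) := Real.one_le_rpow hl (by linarith)
  rcases le_total s R₁ with hsR | hsR
  · have h1 := hB s ⟨hs0, hsR⟩
    rw [Real.norm_of_nonneg (hρ.nonneg s hs0)] at h1
    calc s ^ ρ s ≤ R₁ ^ ρ s := Real.rpow_le_rpow hs0 hsR (hρ.nonneg s hs0)
      _ ≤ R₁ ^ B := Real.rpow_le_rpow_of_exponent_le hR₁1 h1
      _ ≤ R ^ (ord / 2) := (hR₂ R hR2).2
      _ ≤ R ^ ρ R := (hR₂ R hR2).1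
      _ ≤ _ := le_mul_of_one_le_left (by positivity) hl1
  · have hRl : R ≤ l * R := le_mul_of_one_le_left hRpos.le hl
    have h1 : h s ≤ h (l * R) := hmono hsR (hR1.trans hRl) hs
    have h2 : h (l * R) - (ord + ε) * Real.log (l * R) ≤ h R - (ord + ε) * Real.log R :=
      hanti hR1 (hR1.trans hRl) hRl
    rw [Real.log_mul (by linarith) hRpos.ne'] at h2
    rw [hexp s (by linarith), hexp R hRpos, Real.rpow_def_of_pos (by linarith), ← Real.exp_add]
    exact Real.exp_le_exp.mpr (by nlinarith)

/-! ### Convergence of the Taylor series -/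

theorem growthNorm_le_ofReal {n : ℕ} {ρ : ℝ → ℝ} {σ B : ℝ} {f : E n → Cl n}
    (h : ∀ x, ‖f x‖ ≤ B * Real.exp (σ * ‖x‖ ^ ρ ‖x‖)) : growthNorm ρ σ f ≤ ENNReal.ofReal B := by
  refine iSup_le fun x => ENNReal.ofReal_le_ofReal ?_
  rw [neg_mul, Real.exp_neg, ← div_eq_mul_inv, div_le_iff₀ (Real.exp_pos _)]
  exact h x

theorem exists_norm_le_of_growthNorm_lt_top {n : ℕ} {ρ : ℝ → ℝ} {σ : ℝ} {f : E n → Cl n}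
    (h : growthNorm ρ σ f < ⊤) :
    ∃ K : ℝ, 0 ≤ K ∧ ∀ x, ‖f x‖ ≤ K * Real.exp (σ * ‖x‖ ^ ρ ‖x‖) := by
  refine ⟨(growthNorm ρ σ f).toReal, ENNReal.toReal_nonneg, fun x => ?_⟩
  have h1 : ENNReal.ofReal (‖f x‖ * Real.exp (-σ * ‖x‖ ^ ρ ‖x‖)) ≤ growthNorm ρ σ f :=
    le_iSup (fun x => ENNReal.ofReal (‖f x‖ * Real.exp (-σ * ‖x‖ ^ ρ ‖x‖))) x
  rw [ENNReal.ofReal_le_iff_le_toReal h.ne, neg_mul, Real.exp_neg, ← div_eq_mul_inv,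
    div_le_iff₀ (Real.exp_pos _)] at h1
  exact h1

theorem fueter_mul_mem_A {n : ℕ} {ρ : ℝ → ℝ} {ord : ℝ} (hρ : IsProximateOrder ρ ord)
    (hord : 0 < ord) {ε : ℝ} (hε : 0 < ε) (m : Fin n → ℕ) (b : Cl n) :
    (fun x : E n => fueter m x * b) ∈ A n ρ ε := by
  obtain ⟨C, hC, h⟩ := norm_fueter_mul_le m
  obtain ⟨D, hD⟩ := hρ.exists_pow_le hord hε (∑ j, m j)
  refine ⟨isMonogenic_fueter_mul m b, lt_of_le_of_lt
    (growthNorm_le_ofReal (B := C * D * ‖b‖) fun x => ?_) ENNReal.ofReal_lt_top⟩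
  calc ‖fueter m x * b‖ ≤ C * ‖x‖ ^ (∑ j, m j) * ‖b‖ := h x b
    _ ≤ C * (D * Real.exp (ε * ‖x‖ ^ ρ ‖x‖)) * ‖b‖ := by gcongr; exact hD _ (norm_nonneg x)
    _ = _ := by ring

theorem fueterPolynomials_subset_APlus {n : ℕ} {ρ : ℝ → ℝ} {ord : ℝ}
    (hρ : IsProximateOrder ρ ord) (hord : 0 < ord) :
    fueterPolynomials n ⊆ (APlus n ρ 0 : Set (E n → Cl n)) := by
  rintro _ ⟨s, b, rfl⟩ ε hε
  have e : (fun x : E n => ∑ m ∈ s, fueter m x * b m) =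
      ∑ m ∈ s, fun x => fueter m x * b m := by
    funext x; simp
  rw [e]
  exact Submodule.sum_mem _ fun m _ => fueter_mul_mem_A hρ hord (by linarith) m (b m)

theorem taylorSum_mem_fueterPolynomials {n : ℕ} (f : E n → Cl n) (s : Finset (Fin n → ℕ)) :
    taylorSum f s ∈ fueterPolynomials n := ⟨s, taylorCoeff f, rfl⟩

/-- The slack needed to pass from `σ` to `n^ord σ + ε`. -/
theorem exists_slack {c ord σ ε : ℝ} (hc : 0 < c) (hε : 0 < ε) :
    ∃ η : ℝ, 0 < η ∧ η ≤ 1 ∧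
      (σ + η) * ((1 + η) ^ 2 * c) ^ (ord + η) ≤ c ^ ord * σ + ε := by
  have h1 : ContinuousAt (fun η : ℝ => (σ + η) * ((1 + η) ^ 2 * c) ^ (ord + η)) 0 := by
    refine ContinuousAt.mul (by fun_prop) (ContinuousAt.rpow (by fun_prop) (by fun_prop) ?_)
    left; simpa using hc.ne'
  have h2 : (fun η : ℝ => (σ + η) * ((1 + η) ^ 2 * c) ^ (ord + η)) 0 < c ^ ord * σ + ε := by
    simp; linarith [mul_comm σ (c ^ ord)]
  have h3 := (h1.eventually_le_const h2).filter_mono (nhdsWithin_le_nhds (s := Set.Ioi 0))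
  obtain ⟨η, h4, h5⟩ := (h3.and (Ioc_mem_nhdsGT one_pos)).exists
  exact ⟨η, h5.1, h5.2, h4⟩

/-- The terms of the Taylor series are dominated by a summable family. -/
theorem exists_summable_bound {n : ℕ} (hn : 1 ≤ n) {ρ : ℝ → ℝ} {ord : ℝ}
    (hρ : IsProximateOrder ρ ord) (hord : 0 < ord) {σ ε : ℝ} (hσ : 0 ≤ σ) (hε : 0 < ε)
    {f : E n → Cl n} (hf : f ∈ APlus n ρ σ) :
    ∃ B : (Fin n → ℕ) → ℝ, Summable B ∧ ∀ m x, ‖fueter m x * taylorCoeff f m‖ ≤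
      B m * Real.exp (((n : ℝ) ^ ord * σ + ε) * ‖x‖ ^ ρ ‖x‖) := by
  have hn1 : (1 : ℝ) ≤ n := by exact_mod_cast hn
  have hn0 : (0 : ℝ) < n := by linarith
  -- One $\eta$ pays for every loss: the type $\sigma+\eta$, the larger ball in the Cauchy estimate,
  -- the ratio $(1+\eta)^{-1}$ of the final series and the index $ord+\eta$.
  obtain ⟨η, hη, hη1, hslack⟩ := exists_slack (ord := ord) (σ := σ) hn0 hε
  obtain ⟨hmono, hgrow⟩ := hf η hη
  obtain ⟨K, hK, hfK⟩ := exists_norm_le_of_growthNorm_lt_top hgrow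
  have hl : 1 ≤ (1 + η) ^ 2 * (n : ℝ) := by nlinarith
  obtain ⟨R₀, hR₀, hreg⟩ := hρ.exists_rpow_le hord hη hl
  obtain ⟨C, hC, hCau⟩ := exists_cauchy_estimate hn hη hη1
  let τ : ℝ := (n : ℝ) ^ ord * σ + ε
  have hτ : 0 < τ := by positivity
  let D : ℝ := C * (K * Real.exp (τ * R₀ ^ ρ R₀))
  have hD : 0 ≤ D := by positivity
  let b : ℕ → ℝ := fun k =>
    D * ((n.ascFactorial k : ℝ) * ((k.factorial : ℝ))⁻¹ * (((1 + η) * n) ^ k)⁻¹)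
  have hb0 : ∀ k, 0 ≤ b k := fun k => by positivity
  have hcoef : ∀ (l : List (Fin n)) (x : E n),
      ‖((l.length.factorial : ℝ)⁻¹) • (wordProd l x * wordDeriv l f 0)‖ ≤
        b l.length * Real.exp (τ * ‖x‖ ^ ρ ‖x‖) := by
    intro l x
    -- Regular variation is available only from $R_0$ on; smaller $\|x\|$ use $R_0$ at the cost of a
    -- constant factor.
    let R : ℝ := max ‖x‖ R₀
    have hR : R₀ ≤ R := le_max_right _ _
    have hxR : ‖x‖ ≤ R := le_max_left _ _
    have hR0 : 0 < R := by linarith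
    -- The Cauchy radius is $(1+\eta)nR$ and its ball is enlarged by $1+\eta$, whence the dilation
    -- factor $(1+\eta)^2n$.
    have hM : ∀ y : E n, ‖y - 0‖ ≤ (1 + η) * ((1 + η) * n * R) →
        ‖f y‖ ≤ K * Real.exp (τ * R ^ ρ R) := by
      intro y hy
      rw [sub_zero] at hy
      have h1 := hreg R hR ‖y‖ (norm_nonneg _) (by linarith)
      refine (hfK y).trans (mul_le_mul_of_nonneg_left (Real.exp_le_exp.mpr ?_) hK)
      calc (σ + η) * ‖y‖ ^ ρ ‖y‖ ≤
            (σ + η) * (((1 + η) ^ 2 * n) ^ (ord + η) * R ^ ρ R) := by gcongr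
        _ = ((σ + η) * ((1 + η) ^ 2 * n) ^ (ord + η)) * R ^ ρ R := by ring
        _ ≤ τ * R ^ ρ R := by gcongr
    have h1 := hCau f hmono 0 ((1 + η) * n * R) _ (by positivity) hM l
    have h2 : Real.exp (τ * R ^ ρ R) ≤
        Real.exp (τ * R₀ ^ ρ R₀) * Real.exp (τ * ‖x‖ ^ ρ ‖x‖) := by
      rw [← Real.exp_add, Real.exp_le_exp]
      rcases le_total ‖x‖ R₀ with h | h
      · have : R = R₀ := max_eq_right h
        rw [this]
        have : 0 ≤ τ * ‖x‖ ^ ρ ‖x‖ := by positivity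
        linarith
      · have : R = ‖x‖ := max_eq_left h
        rw [this]
        have : 0 ≤ τ * R₀ ^ ρ R₀ := by positivity
        linarith
    have h3 : ‖x‖ ^ l.length * (((1 + η) * n * R) ^ l.length)⁻¹ ≤
        (((1 + η) * n) ^ l.length)⁻¹ := by
      rw [mul_pow _ R, mul_inv, mul_left_comm]
      refine mul_le_of_le_one_right (by positivity) ?_
      rw [← div_eq_mul_inv, div_le_one (by positivity)]
      exact pow_le_pow_left₀ (norm_nonneg _) hxR _
    rw [norm_smul, Real.norm_of_nonneg (by positivity)]
    calc _ ≤ (l.length.factorial : ℝ)⁻¹ * (‖x‖ ^ l.length * (C * n.ascFactorial l.length *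
          (K * Real.exp (τ * R ^ ρ R)) * (((1 + η) * n * R) ^ l.length)⁻¹)) := by
          gcongr
          exact (norm_wordProd_mul_le l x _).trans (by gcongr)
      _ = (l.length.factorial : ℝ)⁻¹ * (C * n.ascFactorial l.length *
          (K * Real.exp (τ * R ^ ρ R))) *
          (‖x‖ ^ l.length * (((1 + η) * n * R) ^ l.length)⁻¹) := by ring
      _ ≤ (l.length.factorial : ℝ)⁻¹ * (C * n.ascFactorial l.length *
          (K * (Real.exp (τ * R₀ ^ ρ R₀) * Real.exp (τ * ‖x‖ ^ ρ ‖x‖)))) *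
          (((1 + η) * n) ^ l.length)⁻¹ := by gcongr
      _ = _ := by simp only [b, D]; ring
  refine ⟨fun m => ∑ w ∈ fueterWords m, b (List.ofFn w).length, ?_, fun m x => ?_⟩
  -- The $n^k$ words of length $k$ are compensated by the $n^{-k}$ in `b k`, leaving the binomial
  -- series in $(1+\eta)^{-1}$.
  · have hsum : Summable fun k : ℕ => (n : ℝ) ^ k * b k := by
      have h1 := (summable_ascFactorial_geometric n hn (t := (1 + η)⁻¹) (by positivity)
        (inv_lt_one_of_one_lt₀ (by linarith))).mul_left D
      refine h1.congr fun k => ?_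
      simp only [b]
      rw [mul_pow, mul_inv, inv_pow]
      field_simp
    refine summable_of_sum_le (c := ∑' k, (n : ℝ) ^ k * b k)
      (fun m => Finset.sum_nonneg fun w _ => hb0 _) fun s => ?_
    -- A finite set of multi-indices has bounded degree, so its sum is at most a sum over all words
    -- up to some length.
    have hs : s ⊆ multiIndexLE n (s.sup fun m => ∑ j, m j) := fun m hm =>
      mem_multiIndexLE.mpr (Finset.le_sup (f := fun m : Fin n → ℕ => ∑ j, m j) hm)
    refine (Finset.sum_le_sum_of_subset_of_nonneg hs fun m _ _ =>
      Finset.sum_nonneg fun w _ => hb0 _).trans ?_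
    rw [sum_multiIndexLE_fueterWords fun l => b l.length]
    simp only [List.length_ofFn, Finset.sum_const, Finset.card_univ, Fintype.card_fun,
      Fintype.card_fin, nsmul_eq_mul, Nat.cast_pow]
    exact hsum.sum_le_tsum _ fun k _ => mul_nonneg (by positivity) (hb0 k)
  · rw [fueter_mul_taylorCoeff (hmono.contDiff hn), Finset.sum_mul]
    exact norm_sum_le_of_le _ fun w _ => hcoef _ x

theorem tendsto_multiIndexLE (n : ℕ) : Tendsto (multiIndexLE n) atTop atTop := by
  refine tendsto_atTop_finset_of_monotone (fun p q hpq m hm => ?_) fun m =>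
    ⟨∑ j, m j, mem_multiIndexLE.mpr le_rfl⟩
  rw [mem_multiIndexLE] at hm ⊢
  omega

/-- The summable majorant gives an unconditional pointwise limit, identified with $f$ along the
partial sums by degree. The error in the weighted norm is then at most the tail of the majorant. -/
theorem convergesAPlus_taylorSum {n : ℕ} (hn : 1 ≤ n) {ρ : ℝ → ℝ} {ord : ℝ}
    (hρ : IsProximateOrder ρ ord) (hord : 0 < ord) {σ : ℝ} (hσ : 0 ≤ σ)
    {f : E n → Cl n} (hf : f ∈ APlus n ρ σ) :
    ConvergesAPlus ρ ((n : ℝ) ^ ord * σ) atTop (fun s => taylorSum f s) f := by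
  intro ε hε
  have hn1 : (1 : ℝ) ≤ n := by exact_mod_cast hn
  have hτ : 0 ≤ (n : ℝ) ^ ord * σ := by positivity
  refine ⟨fun s => A_mono n ρ (by linarith) (fueterPolynomials_subset_APlus hρ hord
    (taylorSum_mem_fueterPolynomials f s) ε hε), A_mono n ρ ?_ (hf ε hε), ?_⟩
  · have := le_mul_of_one_le_left hσ (Real.one_le_rpow hn1 hord.le)
    linarith
  obtain ⟨B, hB, hbound⟩ := exists_summable_bound hn hρ hord hσ hε hf
  have hsummable : ∀ x, Summable fun m => fueter m x * taylorCoeff f m := fun x =>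
    Summable.of_norm_bounded (hB.mul_right _) fun m => hbound m x
  have hlim : ∀ x, Tendsto (fun s => taylorSum f s x) atTop (𝓝 (f x)) := by
    intro x
    have h1 : Tendsto (fun s => taylorSum f s x) atTop (𝓝 _) := (hsummable x).hasSum
    have h2 := tendsto_nhds_unique (h1.comp (tendsto_multiIndexLE n))
      (tendsto_taylorSum_multiIndexLE hn (hf ε hε).1 x)
    rwa [h2] at h1
  have hle : ∀ s, growthNorm ρ ((n : ℝ) ^ ord * σ + ε) (taylorSum f s - f) ≤
      ENNReal.ofReal (∑' m, B m - ∑ m ∈ s, B m) := by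
    intro s
    refine growthNorm_le_ofReal fun x => ?_
    have h1 : Tendsto (fun t => ‖taylorSum f t x - taylorSum f s x‖) atTop
        (𝓝 ‖f x - taylorSum f s x‖) := ((hlim x).sub_const _).norm
    rw [Pi.sub_apply, norm_sub_rev]
    have h2 : Tendsto (fun t => (∑ m ∈ t, B m - ∑ m ∈ s, B m) *
        Real.exp (((n : ℝ) ^ ord * σ + ε) * ‖x‖ ^ ρ ‖x‖)) atTop
        (𝓝 ((∑' m, B m - ∑ m ∈ s, B m) *
          Real.exp (((n : ℝ) ^ ord * σ + ε) * ‖x‖ ^ ρ ‖x‖))) :=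
      (Tendsto.sub_const hB.hasSum _).mul_const _
    -- The error is the limit of differences of partial sums, each bounded by the majorant over
    -- $t\setminus s$.
    refine le_of_tendsto_of_tendsto h1 h2 ?_
    filter_upwards [eventually_ge_atTop s] with t ht
    simp only [taylorSum]
    rw [← Finset.sum_sdiff ht, add_sub_cancel_right, ← Finset.sum_sdiff ht, add_sub_cancel_right,
      Finset.sum_mul]
    exact norm_sum_le_of_le _ fun m _ => hbound m x
  have hzero : Tendsto (fun s => ENNReal.ofReal (∑' m, B m - ∑ m ∈ s, B m)) atTop (𝓝 0) := by
    have h1 : Tendsto (fun s => ∑' m, B m - ∑ m ∈ s, B m) atTop (𝓝 0) := by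
      rw [← sub_self (∑' m, B m)]
      exact Tendsto.const_sub _ hB.hasSum
    simpa using ENNReal.tendsto_ofReal h1
  exact tendsto_of_tendsto_of_tendsto_of_le_of_le tendsto_const_nhds hzero (fun _ => zero_le) hle

theorem ConvergesAPlus.comp {n : ℕ} {ι κ : Type*} {ρ : ℝ → ℝ} {σ : ℝ} {l : Filter ι}
    {l' : Filter κ} {u : ι → E n → Cl n} {f : E n → Cl n} (h : ConvergesAPlus ρ σ l u f)
    {g : κ → ι} (hg : Tendsto g l' l) : ConvergesAPlus ρ σ l' (fun k => u (g k)) f :=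
  fun ε hε => ⟨fun k => (h ε hε).1 (g k), (h ε hε).2.1, (h ε hε).2.2.comp hg⟩

theorem convergesAPlus_taylorSum_multiIndexLE {n : ℕ} (hn : 1 ≤ n) {ρ : ℝ → ℝ} {ord : ℝ}
    (hρ : IsProximateOrder ρ ord) (hord : 0 < ord) {σ : ℝ} (hσ : 0 ≤ σ)
    {f : E n → Cl n} (hf : f ∈ APlus n ρ σ) :
    ConvergesAPlus ρ ((n : ℝ) ^ ord * σ) atTop (fun q => taylorSum f (multiIndexLE n q)) f :=
  (convergesAPlus_taylorSum hn hρ hord hσ hf).comp (tendsto_multiIndexLE n)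

/-! ### Density -/

theorem A.tendsto_of_growthNorm {n : ℕ} {ρ : ℝ → ℝ} {σ : ℝ} {ι : Type*} {l : Filter ι}
    {u : ι → A n ρ σ} {f : A n ρ σ}
    (h : Tendsto (fun i => growthNorm ρ σ ((u i).1 - f.1)) l (𝓝 0)) :
    Tendsto u l (@nhds _ (A.topology n ρ σ) f) := by
  let _ := (A.groupNorm n ρ σ).toNormedAddCommGroup
  refine tendsto_iff_norm_sub_tendsto_zero.mpr ?_
  have h1 := (ENNReal.tendsto_toReal ENNReal.zero_ne_top).comp h
  exact h1

theorem APlus.tendsto_of_convergesAPlus {n : ℕ} {ρ : ℝ → ℝ} {σ : ℝ} {ι : Type*} {l : Filter ι}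
    {u : ι → APlus n ρ σ} {f : APlus n ρ σ}
    (h : ConvergesAPlus ρ σ l (fun i => (u i : E n → Cl n)) f) :
    Tendsto u l (@nhds _ (APlus.topology n ρ σ) f) := by
  simp only [nhds_iInf, nhds_induced, tendsto_iInf, tendsto_comap_iff]
  intro ε hε
  exact A.tendsto_of_growthNorm (h ε hε).2.2

/-- The inclusion of each step is continuous for every topology in the defining infimum, hence for
the infimum itself. -/
theorem AInd.tendsto_of_growthNorm {n : ℕ} {ρ : ℝ → ℝ} {σ : ℝ} (hσ : 0 < σ) {ι : Type*}
    {l : Filter ι} {u : ι → A n ρ σ} {f : A n ρ σ}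
    (h : Tendsto (fun i => growthNorm ρ σ ((u i).1 - f.1)) l (𝓝 0)) :
    Tendsto (fun i => Submodule.inclusion (A_le_AInd n ρ hσ) (u i)) l
      (@nhds _ (AInd.topology n ρ) (Submodule.inclusion (A_le_AInd n ρ hσ) f)) := by
  have hc : @Continuous _ _ (A.topology n ρ σ) (AInd.topology n ρ)
      (Submodule.inclusion (A_le_AInd n ρ hσ)) :=
    continuous_sInf_rng.mpr fun t ht => ht.2.2.2 σ hσ
  let _ := A.topology n ρ σ
  let _ := AInd.topology n ρ
  exact (hc.tendsto f).comp (A.tendsto_of_growthNorm h)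

end Monogenic

theorem proposition3 (n : ℕ) (hn : 1 ≤ n) (ρ : ℝ → ℝ) (ord : ℝ) (hord : 0 < ord)
    (hρ : IsProximateOrder ρ ord) :
    -- the Taylor series converges, unconditionally and when summed by degree
    (∀ σ : ℝ, 0 ≤ σ → ∀ f ∈ APlus n ρ σ,
      ConvergesAPlus ρ ((n : ℝ) ^ ord * σ) atTop (fun s => taylorSum f s) f ∧
      ConvergesAPlus ρ ((n : ℝ) ^ ord * σ) atTop (fun q => taylorSum f (multiIndexLE n q)) f) ∧
    -- density in the space `A_{ρ,+0}`
    (fueterPolynomials n ⊆ APlus n ρ 0 ∧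
      (∀ f ∈ APlus n ρ 0, ∃ u : ℕ → E n → Cl n,
        (∀ j, u j ∈ fueterPolynomials n) ∧ ConvergesAPlus ρ 0 atTop u f) ∧
      @Dense (APlus n ρ 0) (APlus.topology n ρ 0) {p | (p : E n → Cl n) ∈ fueterPolynomials n}) ∧
    -- density in the space `A_ρ`
    (fueterPolynomials n ⊆ AInd n ρ ∧
      (∀ f ∈ AInd n ρ, ∃ u : ℕ → E n → Cl n,
        (∀ j, u j ∈ fueterPolynomials n) ∧ ConvergesAInd ρ atTop u f) ∧
      @Dense (AInd n ρ) (AInd.topology n ρ) {p | (p : E n → Cl n) ∈ fueterPolynomials n}) := by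
  have hsub := fueterPolynomials_subset_APlus (n := n) hρ hord
  have happ : ∀ f ∈ APlus n ρ 0, ∃ u : ℕ → E n → Cl n,
      (∀ j, u j ∈ fueterPolynomials n) ∧ ConvergesAPlus ρ 0 atTop u f := fun f hf =>
    ⟨_, fun q => taylorSum_mem_fueterPolynomials f (multiIndexLE n q), by
      simpa using convergesAPlus_taylorSum_multiIndexLE hn hρ hord le_rfl hf⟩
  have hind : ∀ f ∈ AInd n ρ, ∃ u : ℕ → E n → Cl n,
      (∀ j, u j ∈ fueterPolynomials n) ∧ ConvergesAInd ρ atTop u f := by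
    rintro f ⟨σ, hσ, hf⟩
    have hf' : f ∈ APlus n ρ σ := fun ε hε => A_mono n ρ (by linarith) hf
    -- A single norm suffices for convergence in the inductive limit: the one of type
    -- $n^{ord}\sigma+1$, from $\varepsilon=1$.
    exact ⟨_, fun q => taylorSum_mem_fueterPolynomials f (multiIndexLE n q), _,
      by positivity, convergesAPlus_taylorSum_multiIndexLE hn hρ hord hσ.le hf' 1 one_pos⟩
  refine ⟨fun σ hσ f hf => ⟨convergesAPlus_taylorSum hn hρ hord hσ hf,
    convergesAPlus_taylorSum_multiIndexLE hn hρ hord hσ hf⟩, ⟨hsub, happ, ?_⟩,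
    fun p hp => ⟨0 + 1, by norm_num, hsub hp 1 one_pos⟩, hind, ?_⟩
  · intro f
    obtain ⟨u, hu, hconv⟩ := happ f f.2
    let _ := APlus.topology n ρ 0
    exact mem_closure_of_tendsto (APlus.tendsto_of_convergesAPlus
      (u := fun j => ⟨u j, hsub (hu j)⟩) hconv) (Eventually.of_forall hu)
  · intro f
    obtain ⟨u, hu, σ, hσ, huA, hfA, hconv⟩ := hind f f.2
    let _ := AInd.topology n ρ
    exact mem_closure_of_tendsto (AInd.tendsto_of_growthNorm hσ
      (u := fun j => ⟨u j, huA j⟩) (f := ⟨f, hfA⟩) hconv) (Eventually.of_forall hu)
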